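/- Let $k$ be a field and let $B=B_0\oplus B_1\oplus B_2\oplus\cdots$ be a connected graded $k$-algebra (so $B_0=k$). Let $\mathrm{Gr}\,B$ be the category of $\mathbb Z$-graded left $B$-modules with degree-preserving homomorphisms, let $M(n)$ denote the degree shift $M(n)_i=M_{n+i}$, let $\mathrm{Fdim}\,B\subset \mathrm{Gr}\,B$ be the full subcategory of modules that are unions of their finite-dimensional graded submodules, let $\mathrm{QGr}\,B=\mathrm{Gr}\,B/\mathrm{Fdim}\,B$ be the quotient category, and let $\mathcal O$ be the image of $B$ in $\mathrm{QGr}\,B$. Suppose that (a) $B$ is left graded-coherent, i.e. every finitely generated graded left ideal of $B$ is finitely presented; (b) $B$ contains a graded left ideal of finite codimension that is isomorphic in $\mathrm{Gr}\,B$ to $B(-1)\oplus G$ for some finitely presented graded left $B$-module $G$; (c) every graded left ideal of finite codimension in $B$ contains a non-zero graded left ideal that is free as a left $B$-module and has finite codimension in $B$. Then: (1) $\mathcal O$ is a progenerator (a finitely generated projective generator) in $\mathrm{QGr}\,B$. (2) The functor $\mathrm{Hom}(\mathcal O,-)$ is an equivalence from $\mathrm{QGr}\,B$ to the category of right modules over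 the endomorphism ring $\mathrm{End}_{\mathrm{QGr} B}(\mathcal O)$. (3) If, for every $n\ge 0$, the left ideal $B_{\ge n}=\bigoplus_{i\ge n}B_i$ contains a non-zero free right $B$-module (a right $B$-submodule of $B$), then there is an isomorphism of $k$-algebras $\mathrm{End}_{\mathrm{QGr} B}(\mathcal O)\cong\varinjlim_n \mathrm{End}_{\mathrm{Gr} B}(B_{\ge n})$, where the transition maps $\mathrm{End}_{\mathrm{Gr} B}(B_{\ge n})\to \mathrm{End}_{\mathrm{Gr} B}(B_{\ge n+1})$ are the restrictions $f\mapsto f|_{B_{\ge n+1}}$; under it, the class of $f\in\mathrm{End}_{\mathrm{Gr} B}(B_{\ge n})$ corresponds to the endomorphism that $f$ induces on $\mathcal O$ via the isomorphism in $\mathrm{QGr}\,B$ coming from the inclusion $B_{\ge n}\subset B$. -/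

import Mathlib

set_option linter.unusedVariables false

open CategoryTheory CategoryTheory.Limits

universe u

namespace NCProj

/-- A `ℤ`-graded left module over a `ℤ`-graded `k`-algebra `B = ⨁ 𝒜 i`:
a left `B`-module with a direct sum decomposition `M = ⨁ M_i` such that `B_i M_j ⊆ M_{i+j}`. -/
structure GrMod {k B : Type u} [Field k] [Ring B] [Algebra k B] (𝒜 : ℤ → Submodule k B) where
  /-- the underlying module -/
  carrier : Type u
  [addCommGroup : AddCommGroup carrier]
  [moduleBase : Module k carrier]
  [module : Module B carrier]
  [isScalarTower : IsScalarTower k B carrier]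
  /-- the homogeneous components -/
  grading : ℤ → Submodule k carrier
  isInternal : DirectSum.IsInternal grading
  smul_mem : ∀ {i j : ℤ} {b : B} {m : carrier}, b ∈ 𝒜 i → m ∈ grading j → b • m ∈ grading (i + j)

attribute [instance] GrMod.addCommGroup GrMod.moduleBase GrMod.module GrMod.isScalarTower

variable {k B : Type u} [Field k] [Ring B] [Algebra k B] {𝒜 : ℤ → Submodule k B}

namespace GrMod

instance smulCommClass (M : GrMod 𝒜) : SMulCommClass B k M.carrier :=
  ⟨fun b c m => by rw [← algebraMap_smul B c m, ← algebraMap_smul B c (b • m), smul_smul, smul_smul,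
    Algebra.commutes]⟩

/-- The projection of a graded module onto its component of degree `i`. -/
noncomputable def comp (M : GrMod 𝒜) (i : ℤ) : M.carrier →ₗ[k] M.carrier :=
  letI := M.isInternal.chooseDecomposition
  (M.grading i).subtype ∘ₗ DirectSum.component k ℤ (fun i => M.grading i) i ∘ₗ
    (DirectSum.decomposeLinearEquiv M.grading).toLinearMap

section comp

variable (M : GrMod 𝒜)

theorem comp_mem (i : ℤ) (m : M.carrier) : M.comp i m ∈ M.grading i := by
  simp [comp]

theorem comp_of_mem {i : ℤ} {m : M.carrier} (hm : m ∈ M.grading i) : M.comp i m = m := by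
  let := M.isInternal.chooseDecomposition
  exact DirectSum.decompose_of_mem_same M.grading hm

theorem comp_of_mem_ne {i j : ℤ} {m : M.carrier} (hm : m ∈ M.grading j) (h : j ≠ i) :
    M.comp i m = 0 := by
  let := M.isInternal.chooseDecomposition
  exact DirectSum.decompose_of_mem_ne M.grading hm h

theorem exists_sum_comp (m : M.carrier) : ∃ s : Finset ℤ, ∑ i ∈ s, M.comp i m = m := by
  classical
  let := M.isInternal.chooseDecomposition
  exact ⟨_, DirectSum.sum_support_decompose M.grading m⟩

theorem mem_of_comp_mem {σ : Type*} [SetLike σ M.carrier] [AddSubmonoidClass σ M.carrier] (N : σ)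
    {m : M.carrier} (h : ∀ i, M.comp i m ∈ N) : m ∈ N := by
  obtain ⟨s, hs⟩ := M.exists_sum_comp m
  rw [← hs]
  exact sum_mem fun i _ => h i

theorem ext_comp {m m' : M.carrier} (h : ∀ i, M.comp i m = M.comp i m') : m = m' := by
  rw [← sub_eq_zero]
  refine (Submodule.mem_bot (R := k)).1 (M.mem_of_comp_mem _ fun i => ?_)
  simp [h i]

end comp

/-- A criterion for a family of subspaces to be a grading. -/
theorem isInternal_of_proj {X : Type u} [AddCommGroup X] [Module k X] (gr : ℤ → Submodule k X)
    (c : ℤ → X →ₗ[k] X) (hself : ∀ i, ∀ x ∈ gr i, c i x = x)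
    (hne : ∀ i j, j ≠ i → ∀ x ∈ gr j, c i x = 0) (htop : ∀ x, x ∈ ⨆ i, gr i) :
    DirectSum.IsInternal gr := by
  rw [DirectSum.isInternal_submodule_iff_iSupIndep_and_iSup_eq_top]
  refine ⟨fun i => ?_, eq_top_iff.2 fun x _ => htop x⟩
  rw [Submodule.disjoint_def]
  intro x hx hx'
  have : (⨆ j, ⨆ (_ : j ≠ i), gr j) ≤ LinearMap.ker (c i) :=
    iSup₂_le fun j hj y hy => hne i j hj y hy
  rw [← hself i x hx]
  exact this hx'

/-- Morphisms of graded modules: `B`-linear maps that preserve degrees. -/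
def homSubmodule (M N : GrMod 𝒜) : Submodule k (M.carrier →ₗ[B] N.carrier) where
  carrier := {f | ∀ i, ∀ m ∈ M.grading i, f m ∈ N.grading i}
  add_mem' hf hg i m hm := add_mem (hf i m hm) (hg i m hm)
  zero_mem' i _ _ := zero_mem (N.grading i)
  smul_mem' c _ hf i m hm := Submodule.smul_mem _ c (hf i m hm)

/-- The category `Gr B` of `ℤ`-graded left `B`-modules and degree-preserving homomorphisms. -/
instance category : Category.{u} (GrMod 𝒜) where
  Hom M N := homSubmodule M N
  id M := ⟨LinearMap.id, fun _ _ hm => hm⟩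
  comp f g := ⟨g.1.comp f.1, fun i m hm => g.2 i _ (f.2 i m hm)⟩

/-- The linear map underlying a morphism of graded modules. -/
def lin {M N : GrMod 𝒜} (f : M ⟶ N) : M.carrier →ₗ[B] N.carrier := f.1

/-- The morphism of graded modules given by a degree-preserving linear map. -/
def homMk {M N : GrMod 𝒜} (f : M.carrier →ₗ[B] N.carrier)
    (hf : ∀ i, ∀ m ∈ M.grading i, f m ∈ N.grading i) : M ⟶ N := ⟨f, hf⟩

@[simp] theorem lin_homMk {M N : GrMod 𝒜} (f : M.carrier →ₗ[B] N.carrier)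
    (hf : ∀ i, ∀ m ∈ M.grading i, f m ∈ N.grading i) : lin (homMk f hf) = f := rfl

theorem lin_mem {M N : GrMod 𝒜} (f : M ⟶ N) {i : ℤ} {m : M.carrier} (hm : m ∈ M.grading i) :
    lin f m ∈ N.grading i := f.2 i m hm

theorem hom_ext {M N : GrMod 𝒜} {f g : M ⟶ N} (h : ∀ m, lin f m = lin g m) : f = g :=
  Subtype.ext (LinearMap.ext h)

@[simp] theorem lin_id (M : GrMod 𝒜) (m : M.carrier) : lin (𝟙 M) m = m := rfl

@[simp] theorem lin_comp {M N P : GrMod 𝒜} (f : M ⟶ N) (g : N ⟶ P) (m : M.carrier) :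
    lin (f ≫ g) m = lin g (lin f m) := rfl

theorem comp_lin {M N : GrMod 𝒜} (f : M ⟶ N) (i : ℤ) (m : M.carrier) :
    N.comp i (lin f m) = lin f (M.comp i m) := by
  classical
  obtain ⟨s, hs⟩ := M.exists_sum_comp m
  have key : ∀ j, N.comp i (lin f (M.comp j m)) = lin f (M.comp i (M.comp j m)) := by
    intro j
    by_cases h : j = i
    · subst h
      rw [N.comp_of_mem (lin_mem f (M.comp_mem _ _)), M.comp_of_mem (M.comp_mem _ _)]
    · rw [N.comp_of_mem_ne (lin_mem f (M.comp_mem _ _)) h, M.comp_of_mem_ne (M.comp_mem _ _) h,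
        map_zero]
  conv_lhs => rw [← hs]
  conv_rhs => rw [← hs]
  simp only [map_sum, key]

instance preadditive : Preadditive (GrMod 𝒜) where
  homGroup M N := inferInstanceAs (AddCommGroup (homSubmodule M N))
  add_comp _ _ _ f f' g := Subtype.ext (LinearMap.comp_add f.1 f'.1 g.1)
  comp_add _ _ _ _ _ _ := rfl

instance linear : Linear k (GrMod 𝒜) where
  homModule M N := inferInstanceAs (Module k (homSubmodule M N))
  smul_comp _ _ _ c f g := hom_ext fun m => by
    change lin g (c • lin f m) = c • lin g (lin f m)
    rw [← algebraMap_smul B c, map_smul, algebraMap_smul]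
  comp_smul _ _ _ _ _ _ := rfl

@[simp] theorem lin_zero {M N : GrMod 𝒜} (m : M.carrier) : lin (0 : M ⟶ N) m = 0 := rfl

@[simp] theorem lin_add {M N : GrMod 𝒜} (f g : M ⟶ N) (m : M.carrier) :
    lin (f + g) m = lin f m + lin g m := rfl

@[simp] theorem lin_smul {M N : GrMod 𝒜} (c : k) (f : M ⟶ N) (m : M.carrier) :
    lin (c • f) m = c • lin f m := rfl

/-- Graded submodules: those containing the homogeneous components of all their elements. -/
def IsGraded (M : GrMod 𝒜) (N : Submodule B M.carrier) : Prop :=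
  ∀ m ∈ N, ∀ i, M.comp i m ∈ N

/-- A graded submodule as a graded module. -/
abbrev ofSub (M : GrMod 𝒜) (N : Submodule B M.carrier) (hN : M.IsGraded N) : GrMod 𝒜 where
  carrier := N
  grading i := (M.grading i).comap ((N.subtype).restrictScalars k)
  isInternal := by
    let c : ℤ → N →ₗ[k] N := fun i =>
      { toFun := fun x => ⟨M.comp i x.1, hN _ x.2 i⟩
        map_add' := fun x y => Subtype.ext (by simp)
        map_smul' := fun a x => Subtype.ext (by simp) }
    refine isInternal_of_proj _ c (fun i x hx => Subtype.ext (M.comp_of_mem hx))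
      (fun i j hij x hx => Subtype.ext (M.comp_of_mem_ne hx hij)) fun x => ?_
    obtain ⟨s, hs⟩ := M.exists_sum_comp x.1
    have : x = ∑ i ∈ s, c i x := Subtype.ext (by
      rw [AddSubmonoidClass.coe_finsetSum]; exact hs.symm)
    rw [this]
    exact sum_mem fun i _ => Submodule.mem_iSup_of_mem i (M.comp_mem i x.1)
  smul_mem hb hm := M.smul_mem hb hm

/-- The inclusion of a graded submodule. -/
def incl (M : GrMod 𝒜) (N : Submodule B M.carrier) (hN : M.IsGraded N) : M.ofSub N hN ⟶ M :=
  homMk N.subtype fun _ _ hm => hm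

/-- The quotient by a graded submodule. -/
abbrev quot (M : GrMod 𝒜) (N : Submodule B M.carrier) (hN : M.IsGraded N) : GrMod 𝒜 where
  carrier := M.carrier ⧸ N
  grading i := (M.grading i).map (N.mkQ.restrictScalars k)
  isInternal := by
    have hker : ∀ i, N.restrictScalars k ≤
        LinearMap.ker (N.mkQ.restrictScalars k ∘ₗ M.comp i) := fun i x hx =>
      (Submodule.Quotient.mk_eq_zero N).2 (hN x hx i)
    let c : ℤ → (M.carrier ⧸ N) →ₗ[k] (M.carrier ⧸ N) := fun i =>
      (N.restrictScalars k).liftQ (N.mkQ.restrictScalars k ∘ₗ M.comp i) (hker i)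
    refine isInternal_of_proj _ c ?_ ?_ ?_
    · rintro i _ ⟨m, hm, rfl⟩
      exact congrArg N.mkQ (M.comp_of_mem hm)
    · rintro i j hij _ ⟨m, hm, rfl⟩
      exact (congrArg N.mkQ (M.comp_of_mem_ne hm hij)).trans (map_zero _)
    · intro x
      obtain ⟨m, rfl⟩ := N.mkQ_surjective x
      obtain ⟨s, hs⟩ := M.exists_sum_comp m
      rw [← hs, map_sum]
      exact sum_mem fun i _ => Submodule.mem_iSup_of_mem i ⟨_, M.comp_mem i m, rfl⟩
  smul_mem := by
    rintro i j b _ hb ⟨m, hm, rfl⟩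
    exact ⟨b • m, M.smul_mem hb hm, rfl⟩

/-- The projection onto the quotient by a graded submodule. -/
def proj (M : GrMod 𝒜) (N : Submodule B M.carrier) (hN : M.IsGraded N) : M ⟶ M.quot N hN :=
  homMk N.mkQ fun _ m hm => ⟨m, hm, rfl⟩

/-- The direct sum of two graded modules. -/
abbrev prod (M N : GrMod 𝒜) : GrMod 𝒜 where
  carrier := M.carrier × N.carrier
  grading i := (M.grading i).prod (N.grading i)
  isInternal := by
    refine isInternal_of_proj _ (fun i => (M.comp i).prodMap (N.comp i)) ?_ ?_ ?_
    · rintro i ⟨x, y⟩ ⟨hx, hy⟩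
      exact Prod.ext (M.comp_of_mem hx) (N.comp_of_mem hy)
    · rintro i j hij ⟨x, y⟩ ⟨hx, hy⟩
      exact Prod.ext (M.comp_of_mem_ne hx hij) (N.comp_of_mem_ne hy hij)
    · rintro ⟨x, y⟩
      obtain ⟨s, hs⟩ := M.exists_sum_comp x
      obtain ⟨t, ht⟩ := N.exists_sum_comp y
      have : (x, y) = ∑ i ∈ s, LinearMap.inl k M.carrier N.carrier (M.comp i x) +
          ∑ i ∈ t, LinearMap.inr k M.carrier N.carrier (N.comp i y) := by
        rw [← map_sum, ← map_sum, hs, ht]; simp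
      rw [this]
      refine add_mem (sum_mem fun i _ => Submodule.mem_iSup_of_mem i ?_)
        (sum_mem fun i _ => Submodule.mem_iSup_of_mem i ?_)
      · exact ⟨M.comp_mem i x, zero_mem _⟩
      · exact ⟨zero_mem _, N.comp_mem i y⟩
  smul_mem hb hm := ⟨M.smul_mem hb hm.1, N.smul_mem hb hm.2⟩

/-- The degree shift `M(n)`, with `M(n)_i = M_{n+i}`. -/
abbrev shift (M : GrMod 𝒜) (n : ℤ) : GrMod 𝒜 where
  carrier := M.carrier
  grading i := M.grading (n + i)
  isInternal := by
    refine isInternal_of_proj _ (fun i => M.comp (n + i)) (fun i x hx => M.comp_of_mem hx)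
      (fun i j hij x hx => M.comp_of_mem_ne hx (by omega)) fun x => ?_
    obtain ⟨s, hs⟩ := M.exists_sum_comp x
    rw [← hs]
    refine sum_mem fun i _ => Submodule.mem_iSup_of_mem (i - n) ?_
    have := M.comp_mem i x
    rwa [show n + (i - n) = i by ring]
  smul_mem {i j} _ _ hb hm := by
    have := M.smul_mem hb hm
    rwa [show i + (n + j) = n + (i + j) by ring] at this

variable (𝒜) in
/-- The graded left module `B`. -/
abbrev self [GradedAlgebra 𝒜] : GrMod 𝒜 where
  carrier := B
  grading := 𝒜
  isInternal := DirectSum.Decomposition.isInternal 𝒜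
  smul_mem hb hm := SetLike.mul_mem_graded hb hm

/-! ### `Gr B` is abelian -/

theorem isGraded_ker {M N : GrMod 𝒜} (f : M ⟶ N) : M.IsGraded (LinearMap.ker (lin f)) := by
  intro m hm i
  rw [LinearMap.mem_ker] at hm ⊢
  rw [← comp_lin, hm, map_zero]

theorem isGraded_map {M N : GrMod 𝒜} (f : M ⟶ N) {P : Submodule B M.carrier} (hP : M.IsGraded P) :
    N.IsGraded (P.map (lin f)) := by
  rintro _ ⟨m, hm, rfl⟩ i
  exact ⟨M.comp i m, hP m hm i, (comp_lin f i m).symm⟩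

theorem isGraded_comap {M N : GrMod 𝒜} (f : M ⟶ N) {P : Submodule B N.carrier}
    (hP : N.IsGraded P) : M.IsGraded (P.comap (lin f)) := by
  intro m hm i
  rw [Submodule.mem_comap, ← comp_lin]
  exact hP _ hm i

theorem isGraded_range {M N : GrMod 𝒜} (f : M ⟶ N) : N.IsGraded (LinearMap.range (lin f)) := by
  rintro _ ⟨m, rfl⟩ i
  exact ⟨M.comp i m, (comp_lin f i m).symm⟩

theorem isGraded_bot (M : GrMod 𝒜) : M.IsGraded ⊥ := by
  intro m hm i
  rw [Submodule.mem_bot] at hm ⊢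
  rw [hm, map_zero]

theorem isGraded_sup (M : GrMod 𝒜) {P Q : Submodule B M.carrier} (hP : M.IsGraded P)
    (hQ : M.IsGraded Q) : M.IsGraded (P ⊔ Q) := by
  intro m hm i
  obtain ⟨x, hx, y, hy, rfl⟩ := Submodule.mem_sup.1 hm
  rw [map_add]
  exact Submodule.add_mem_sup (hP x hx i) (hQ y hy i)

/-- The kernel of a morphism of graded modules. -/
noncomputable def isLimitKer {M N : GrMod 𝒜} (f : M ⟶ N) :
    IsLimit (KernelFork.ofι (f := f) (M.incl _ (isGraded_ker f)) (hom_ext fun m => m.2)) :=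
  KernelFork.IsLimit.ofι _ _
    (fun g hg => homMk (N := M.ofSub _ (isGraded_ker f)) ((lin g).codRestrict _ fun x =>
      congrArg (fun h => lin h x) hg) fun i x hx => lin_mem g hx)
    (fun g hg => hom_ext fun x => rfl)
    (fun g hg h hh => hom_ext fun x => Subtype.ext (congrArg (fun h => lin h x) hh))

/-- The cokernel of a morphism of graded modules. -/
noncomputable def isColimitCoker {M N : GrMod 𝒜} (f : M ⟶ N) :
    IsColimit (CokernelCofork.ofπ (f := f) (N.proj _ (isGraded_range f))
      (hom_ext fun m => (Submodule.Quotient.mk_eq_zero _).2 ⟨m, rfl⟩)) :=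
  CokernelCofork.IsColimit.ofπ _ _
    (fun g hg => homMk (M := N.quot _ (isGraded_range f)) ((LinearMap.range (lin f)).liftQ (lin g)
      (by rintro _ ⟨x, rfl⟩; exact congrArg (fun h => lin h x) hg))
      (by rintro i _ ⟨x, hx, rfl⟩; exact lin_mem g hx))
    (fun g hg => hom_ext fun x => rfl)
    (fun g hg h hh => hom_ext fun x => by
      obtain ⟨y, rfl⟩ := Submodule.mkQ_surjective _ x
      exact congrArg (fun h => lin h y) hh)

instance hasKernels : HasKernels (GrMod 𝒜) := ⟨fun f => ⟨⟨_, isLimitKer f⟩⟩⟩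

instance hasCokernels : HasCokernels (GrMod 𝒜) := ⟨fun f => ⟨⟨_, isColimitCoker f⟩⟩⟩

instance hasBinaryProducts : HasBinaryProducts (GrMod 𝒜) :=
  have (M N : GrMod 𝒜) : HasLimit (pair M N) := ⟨⟨{
    cone := BinaryFan.mk (P := M.prod N) (homMk (M := M.prod N) (LinearMap.fst B _ _) fun _ _ h => h.1)
      (homMk (M := M.prod N) (LinearMap.snd B _ _) fun _ _ h => h.2)
    isLimit := BinaryFan.IsLimit.mk _
      (fun f g => homMk (N := M.prod N) ((lin f).prod (lin g))
        fun i m hm => ⟨lin_mem f hm, lin_mem g hm⟩)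
      (fun f g => rfl) (fun f g => rfl)
      (fun f g m h₁ h₂ => hom_ext fun x => Prod.ext (congrArg (fun h => lin h x) h₁)
        (congrArg (fun h => lin h x) h₂)) }⟩⟩
  hasBinaryProducts_of_hasLimit_pair _

variable (𝒜) in
/-- The zero module. -/
def zeroMod : GrMod 𝒜 where
  carrier := PUnit
  grading _ := ⊤
  isInternal := isInternal_of_proj _ (fun _ => 0) (fun _ _ _ => rfl) (fun _ _ _ _ _ => rfl)
    fun _ => Submodule.mem_iSup_of_mem 0 trivial
  smul_mem _ _ := trivial

theorem isZero_zeroMod : IsZero (zeroMod 𝒜) := by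
  rw [IsZero.iff_id_eq_zero]
  exact hom_ext fun _ => rfl

instance hasZeroObject : HasZeroObject (GrMod 𝒜) := ⟨⟨_, isZero_zeroMod⟩⟩

instance hasFiniteProducts : HasFiniteProducts (GrMod 𝒜) :=
  hasFiniteProducts_of_has_binary_and_terminal

theorem injective_of_mono {M N : GrMod 𝒜} (f : M ⟶ N) [Mono f] : Function.Injective (lin f) := by
  rw [← LinearMap.ker_eq_bot, eq_bot_iff]
  intro m hm
  have h : M.incl _ (isGraded_ker f) = 0 := by
    rw [← cancel_mono f, zero_comp]
    exact hom_ext fun x => x.2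
  exact congrArg (fun g => lin g (⟨m, hm⟩ : LinearMap.ker (lin f))) h

theorem surjective_of_epi {M N : GrMod 𝒜} (f : M ⟶ N) [Epi f] : Function.Surjective (lin f) := by
  intro n
  have h : N.proj _ (isGraded_range f) = 0 := by
    rw [← cancel_epi f, comp_zero]
    exact hom_ext fun x => (Submodule.Quotient.mk_eq_zero _).2 ⟨x, rfl⟩
  exact (Submodule.Quotient.mk_eq_zero _).1 (congrArg (fun g => lin g n) h)

theorem mono_of_injective {M N : GrMod 𝒜} (f : M ⟶ N) (hf : Function.Injective (lin f)) :
    Mono f :=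
  ⟨fun g h hgh => hom_ext fun x => hf (congrArg (fun g => lin g x) hgh)⟩

theorem epi_of_surjective {M N : GrMod 𝒜} (f : M ⟶ N) (hf : Function.Surjective (lin f)) :
    Epi f :=
  ⟨fun g h hgh => hom_ext fun x => by
    obtain ⟨y, rfl⟩ := hf x
    exact congrArg (fun g => lin g y) hgh⟩

theorem mem_grading_of_injective {M N : GrMod 𝒜} (f : M ⟶ N) (hf : Function.Injective (lin f))
    {i : ℤ} {m : M.carrier} (hm : lin f m ∈ N.grading i) : m ∈ M.grading i := by
  have : m = M.comp i m := hf (by rw [← comp_lin, N.comp_of_mem hm])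
  rw [this]
  exact M.comp_mem i m

/-- A morphism whose image is contained in that of a monomorphism factors through it. -/
theorem exists_lift {M N P : GrMod 𝒜} (f : M ⟶ N) (hf : Function.Injective (lin f)) (g : P ⟶ N)
    (hg : ∀ x, lin g x ∈ LinearMap.range (lin f)) : ∃ h : P ⟶ M, h ≫ f = g := by
  let e := LinearEquiv.ofInjective (lin f) hf
  have he : ∀ x, lin f (e.symm ⟨lin g x, hg x⟩) = lin g x := fun x =>
    congrArg Subtype.val (e.apply_symm_apply ⟨lin g x, hg x⟩)
  refine ⟨homMk (e.symm.toLinearMap.comp ((lin g).codRestrict _ hg)) fun i x hx => ?_,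
    hom_ext he⟩
  refine mem_grading_of_injective f hf ?_
  have := lin_mem g hx
  rwa [← he x] at this

/-- A morphism that kills the kernel of an epimorphism factors through it. -/
theorem exists_desc {M N P : GrMod 𝒜} (f : M ⟶ N) (hf : Function.Surjective (lin f)) (g : M ⟶ P)
    (hg : LinearMap.ker (lin f) ≤ LinearMap.ker (lin g)) : ∃ h : N ⟶ P, f ≫ h = g := by
  let e := (lin f).quotKerEquivOfSurjective hf
  let l : N.carrier →ₗ[B] P.carrier := ((LinearMap.ker (lin f)).liftQ (lin g) hg).comp
    e.symm.toLinearMap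
  have hl : ∀ x, l (lin f x) = lin g x := fun x => by
    have : e.symm (lin f x) = Submodule.Quotient.mk x := e.symm_apply_eq.2 rfl
    simp [l, this]
  refine ⟨homMk l fun i n hn => ?_, hom_ext hl⟩
  obtain ⟨m, rfl⟩ := hf n
  rw [← N.comp_of_mem hn, comp_lin, hl]
  exact lin_mem g (M.comp_mem i m)

instance isNormalMonoCategory : IsNormalMonoCategory (GrMod 𝒜) where
  normalMonoOfMono {M N} f _ := ⟨{
    Z := N.quot _ (isGraded_range f)
    g := N.proj _ (isGraded_range f)
    w := hom_ext fun x => (Submodule.Quotient.mk_eq_zero _).2 ⟨x, rfl⟩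
    isLimit := KernelFork.IsLimit.ofι' _ _ fun g hg =>
      have h := exists_lift f (injective_of_mono f) g fun x =>
        (Submodule.Quotient.mk_eq_zero _).1 (congrArg (fun g => lin g x) hg)
      ⟨h.choose, h.choose_spec⟩ }⟩

instance isNormalEpiCategory : IsNormalEpiCategory (GrMod 𝒜) where
  normalEpiOfEpi {M N} f _ := ⟨{
    W := M.ofSub _ (isGraded_ker f)
    g := M.incl _ (isGraded_ker f)
    w := hom_ext fun x => x.2
    isColimit := CokernelCofork.IsColimit.ofπ' _ _ fun g hg =>
      have h := exists_desc f (surjective_of_epi f) g fun x hx =>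
        show lin g x = 0 from congrArg (fun g => lin g (⟨x, hx⟩ : LinearMap.ker (lin f))) hg
      ⟨h.choose, h.choose_spec⟩ }⟩

instance abelian : Abelian (GrMod 𝒜) where

end GrMod

namespace GrMod

/-! ### The subcategory `Fdim B` -/

/-- Elements lying in a finite-dimensional graded submodule. -/
def IsFdimElt (M : GrMod 𝒜) (m : M.carrier) : Prop :=
  ∃ N : Submodule B M.carrier, M.IsGraded N ∧ Module.Finite k N ∧ m ∈ N

variable (𝒜) in
/-- `Fdim B`: the graded modules that are unions of their finite-dimensional graded submodules. -/
def fdim : ObjectProperty (GrMod 𝒜) := fun M => ∀ m : M.carrier, M.IsFdimElt m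

theorem finite_sup {M : GrMod 𝒜} {N N' : Submodule B M.carrier} (h : Module.Finite k N)
    (h' : Module.Finite k N') : Module.Finite k (N ⊔ N' : Submodule B M.carrier) := by
  let l : (N × N') →ₗ[B] M.carrier := N.subtype.coprod N'.subtype
  have hl : LinearMap.range l = N ⊔ N' := by simp [l, LinearMap.range_coprod]
  rw [← hl]
  exact Module.Finite.of_surjective (l.rangeRestrict.restrictScalars k) l.surjective_rangeRestrict

theorem finite_map {M N : GrMod 𝒜} (f : M ⟶ N) {P : Submodule B M.carrier}
    (h : Module.Finite k P) : Module.Finite k (P.map (lin f)) :=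
  Module.Finite.of_surjective (((lin f).submoduleMap P).restrictScalars k)
    ((lin f).submoduleMap_surjective P)

theorem finite_comap {M N : GrMod 𝒜} (f : M ⟶ N) (hf : Function.Injective (lin f))
    {P : Submodule B N.carrier} (h : Module.Finite k P) : Module.Finite k (P.comap (lin f)) :=
  Module.Finite.of_injective
    ((((lin f).comp (P.comap (lin f)).subtype).codRestrict P fun x => x.2).restrictScalars k)
    fun x y hxy => Subtype.ext (hf (congrArg Subtype.val hxy))

theorem IsFdimElt.add {M : GrMod 𝒜} {m m' : M.carrier} (h : M.IsFdimElt m) (h' : M.IsFdimElt m') :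
    M.IsFdimElt (m + m') := by
  obtain ⟨N, hN, hf, hm⟩ := h
  obtain ⟨N', hN', hf', hm'⟩ := h'
  exact ⟨N ⊔ N', M.isGraded_sup hN hN', finite_sup hf hf', Submodule.add_mem_sup hm hm'⟩

theorem isFdimElt_zero (M : GrMod 𝒜) : M.IsFdimElt 0 :=
  ⟨⊥, M.isGraded_bot, inferInstance, zero_mem _⟩

theorem IsFdimElt.map {M N : GrMod 𝒜} (f : M ⟶ N) {m : M.carrier} (h : M.IsFdimElt m) :
    N.IsFdimElt (lin f m) := by
  obtain ⟨P, hP, hf, hm⟩ := h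
  exact ⟨P.map (lin f), isGraded_map f hP, finite_map f hf, m, hm, rfl⟩

theorem IsFdimElt.of_map {M N : GrMod 𝒜} (f : M ⟶ N) (hf : Function.Injective (lin f))
    {m : M.carrier} (h : N.IsFdimElt (lin f m)) : M.IsFdimElt m := by
  obtain ⟨P, hP, hfin, hm⟩ := h
  exact ⟨P.comap (lin f), isGraded_comap f hP, finite_comap f hf hfin, hm⟩

theorem fdim_of_homogeneous {M : GrMod 𝒜} (h : ∀ i, ∀ m ∈ M.grading i, M.IsFdimElt m) :
    fdim 𝒜 M := by
  intro m
  obtain ⟨s, hs⟩ := M.exists_sum_comp m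
  rw [← hs]
  exact Finset.sum_induction _ _ (fun _ _ => IsFdimElt.add) M.isFdimElt_zero
    fun i _ => h i _ (M.comp_mem i m)

/-- The components of a product with a homogeneous left factor. -/
theorem comp_smul_of_mem_left (M : GrMod 𝒜) {d : ℤ} {b : B} (hb : b ∈ 𝒜 d) (i : ℤ)
    (m : M.carrier) : M.comp (d + i) (b • m) = b • M.comp i m := by
  obtain ⟨s, hs⟩ := M.exists_sum_comp m
  have key : ∀ j, M.comp (d + i) (b • M.comp j m) = b • M.comp i (M.comp j m) := by
    intro j
    have hj := M.smul_mem hb (M.comp_mem j m)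
    by_cases h : j = i
    · subst h
      rw [M.comp_of_mem hj, M.comp_of_mem (M.comp_mem _ _)]
    · rw [M.comp_of_mem_ne hj (by omega), M.comp_of_mem_ne (M.comp_mem _ _) h, smul_zero]
  conv_lhs => rw [← hs]
  conv_rhs => rw [← hs]
  simp only [map_sum, Finset.smul_sum, key]

section algebra

variable [GradedAlgebra 𝒜]

theorem proj_mem (i : ℤ) (b : B) : GradedAlgebra.proj 𝒜 i b ∈ 𝒜 i := by
  rw [GradedAlgebra.proj_apply]
  exact SetLike.coe_mem _

theorem exists_sum_proj (b : B) : ∃ s : Finset ℤ, ∑ i ∈ s, GradedAlgebra.proj 𝒜 i b = b := by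
  classical
  exact ⟨_, DirectSum.sum_support_decompose 𝒜 b⟩

theorem proj_of_mem {i : ℤ} {b : B} (hb : b ∈ 𝒜 i) : GradedAlgebra.proj 𝒜 i b = b :=
  DirectSum.decompose_of_mem_same 𝒜 hb

theorem proj_of_mem_ne {i j : ℤ} {b : B} (hb : b ∈ 𝒜 j) (h : j ≠ i) :
    GradedAlgebra.proj 𝒜 i b = 0 :=
  DirectSum.decompose_of_mem_ne 𝒜 hb h

/-- The projections of the graded module `B` are those of the graded algebra `B`. -/
theorem comp_self (i : ℤ) (b : B) : (self 𝒜).comp i b = GradedAlgebra.proj 𝒜 i b := by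
  obtain ⟨s, hs⟩ := exists_sum_proj (𝒜 := 𝒜) b
  have key : ∀ j, (self 𝒜).comp i (GradedAlgebra.proj 𝒜 j b) =
      GradedAlgebra.proj 𝒜 i (GradedAlgebra.proj 𝒜 j b) := by
    intro j
    by_cases h : j = i
    · subst h
      rw [(self 𝒜).comp_of_mem (proj_mem j b), proj_of_mem (proj_mem j b)]
    · rw [(self 𝒜).comp_of_mem_ne (proj_mem j b) h, proj_of_mem_ne (proj_mem j b) h]
  conv_lhs => rw [← hs]
  conv_rhs => rw [← hs]
  simp only [map_sum, key]

/-- The components of a product with a homogeneous right factor. -/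
theorem comp_smul_of_mem (M : GrMod 𝒜) {d : ℤ} {m : M.carrier} (hm : m ∈ M.grading d) (i : ℤ)
    (b : B) : M.comp (i + d) (b • m) = GradedAlgebra.proj 𝒜 i b • m := by
  obtain ⟨s, hs⟩ := exists_sum_proj (𝒜 := 𝒜) b
  have key : ∀ j, M.comp (i + d) (GradedAlgebra.proj 𝒜 j b • m) =
      GradedAlgebra.proj 𝒜 i (GradedAlgebra.proj 𝒜 j b) • m := by
    intro j
    have hj := M.smul_mem (proj_mem (𝒜 := 𝒜) j b) hm
    by_cases h : j = i
    · subst h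
      rw [M.comp_of_mem hj, proj_of_mem (proj_mem j b)]
    · rw [M.comp_of_mem_ne hj (by omega), proj_of_mem_ne (proj_mem j b) h, zero_smul]
  conv_lhs => rw [← hs]
  conv_rhs => rw [← hs]
  simp only [map_sum, Finset.sum_smul, key]

theorem isGraded_span (M : GrMod 𝒜) {d : ℤ} {m : M.carrier} (hm : m ∈ M.grading d) :
    M.IsGraded (Submodule.span B {m}) := by
  intro x hx i
  obtain ⟨b, rfl⟩ := Submodule.mem_span_singleton.1 hx
  rw [show i = (i - d) + d by ring, M.comp_smul_of_mem hm]
  exact Submodule.smul_mem _ _ (Submodule.mem_span_singleton_self m)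

end algebra

end GrMod

/-! ### Connected graded algebras -/

open GrMod

/-- `B` is connected graded: `B = B_0 ⊕ B_1 ⊕ B_2 ⊕ ⋯` and `B_0 = k`. -/
class IsConnectedGraded (𝒜 : ℤ → Submodule k B) [GradedAlgebra 𝒜] : Prop where
  nontrivial : Nontrivial B
  eq_bot_of_neg : ∀ i < 0, 𝒜 i = ⊥
  exists_algebraMap_eq : ∀ b ∈ 𝒜 0, ∃ c : k, algebraMap k B c = b

/-- `B` is left graded-coherent: its finitely generated graded left ideals are finitely presented. -/
class IsLeftGradedCoherent (𝒜 : ℤ → Submodule k B) [GradedAlgebra 𝒜] : Prop where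
  finitePresentation : ∀ I : Submodule B B, (self 𝒜).IsGraded I → I.FG →
    Module.FinitePresentation B I

/-- `B` contains a graded left ideal of finite codimension that is isomorphic, as a graded module,
to `B(-1) ⊕ G` for some finitely presented graded module `G`. -/
class HasTwistIdeal (𝒜 : ℤ → Submodule k B) [GradedAlgebra 𝒜] : Prop where
  exists_ideal : ∃ (I : Submodule B B) (hI : (self 𝒜).IsGraded I), Module.Finite k (B ⧸ I) ∧
    ∃ G : GrMod 𝒜, Module.FinitePresentation B G.carrier ∧
      Nonempty ((self 𝒜).ofSub I hI ≅ ((self 𝒜).shift (-1)).prod G)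

section tail

variable (𝒜) [GradedAlgebra 𝒜] [IsConnectedGraded 𝒜]

/-- The left ideal `B_{≥ n}`: the elements whose components of degree less than `n` vanish. -/
def tail (n : ℤ) : Submodule B B where
  carrier := {b | ∀ i < n, GradedAlgebra.proj 𝒜 i b = 0}
  add_mem' ha hb i hi := by rw [map_add, ha i hi, hb i hi, add_zero]
  zero_mem' i _ := map_zero _
  smul_mem' a b hb i hi := by
    obtain ⟨s, hs⟩ := exists_sum_proj (𝒜 := 𝒜) a
    rw [← hs, Finset.sum_smul, map_sum]
    refine Finset.sum_eq_zero fun j _ => ?_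
    have hj := proj_mem (𝒜 := 𝒜) j a
    rcases lt_or_ge j 0 with h | h
    · rw [IsConnectedGraded.eq_bot_of_neg (𝒜 := 𝒜) j h, Submodule.mem_bot] at hj
      rw [hj, zero_smul, map_zero]
    · have := (self 𝒜).comp_smul_of_mem_left hj (i - j) b
      rw [comp_self, comp_self, hb (i - j) (by omega), show j + (i - j) = i by ring] at this
      exact this.trans (smul_zero _)

theorem isGraded_tail (n : ℤ) : (self 𝒜).IsGraded (tail 𝒜 n) := by
  intro b hb i j hj
  rw [comp_self]
  by_cases h : i = j
  · subst h
    rw [hb i hj, map_zero]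
  · exact proj_of_mem_ne (proj_mem i b) h

variable {𝒜}

theorem exists_mul_mem {I : Submodule B B} (hI : (self 𝒜).IsGraded I) (hne : I ≠ ⊤)
    (hfin : Module.Finite k (B ⧸ I)) :
    ∃ d, ∃ x ∈ 𝒜 d, x ∉ I ∧ ∀ b : B, b • x ∈ I ↔ b ∈ tail 𝒜 1 := by
  have hQ := ((self 𝒜).quot I hI).isInternal.submodule_iSupIndep
  have hS : {i | ((self 𝒜).quot I hI).grading i ≠ ⊥}.Finite :=
    WellFoundedGT.finite_ne_bot_of_iSupIndep hQ
  have hmem : ∀ {i : ℤ} {x : B}, x ∈ 𝒜 i → x ∉ I → ((self 𝒜).quot I hI).grading i ≠ ⊥ := by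
    intro i x hx hxI h
    have h1 : I.mkQ x ∈ ((self 𝒜).quot I hI).grading i := ⟨x, hx, rfl⟩
    rw [h, Submodule.mem_bot] at h1
    exact hxI ((Submodule.Quotient.mk_eq_zero I).1 h1)
  have h1 : (1 : B) ∉ I := fun h => hne (eq_top_iff.2 fun b _ => by
    simpa using I.smul_mem b h)
  obtain ⟨d, hd, hmax⟩ := hS.exists_maximal ⟨0, hmem (SetLike.one_mem_graded 𝒜) h1⟩
  obtain ⟨q, hq, hq0⟩ := (Submodule.ne_bot_iff _).1 hd
  obtain ⟨x, hx, rfl⟩ := hq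
  have hxI : x ∉ I := fun h => hq0 ((Submodule.Quotient.mk_eq_zero I).2 h)
  refine ⟨d, x, hx, hxI, fun b => ⟨fun hb i hi => ?_, fun hb => ?_⟩⟩
  · have hb0 := proj_mem (𝒜 := 𝒜) i b
    rcases lt_or_eq_of_le (show i ≤ 0 by omega) with h | rfl
    · rwa [IsConnectedGraded.eq_bot_of_neg (𝒜 := 𝒜) i h, Submodule.mem_bot] at hb0
    · obtain ⟨c, hc⟩ := IsConnectedGraded.exists_algebraMap_eq (𝒜 := 𝒜) _ hb0
      have h2 := (self 𝒜).comp_smul_of_mem hx 0 b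
      have h3 : GradedAlgebra.proj 𝒜 0 b • x ∈ I := by
        have := hI _ hb (0 + d)
        rwa [h2] at this
      rw [← hc] at h3 ⊢
      by_cases hc0 : c = 0
      · simp [hc0]
      · refine absurd ?_ hxI
        have h4 := I.smul_mem (algebraMap k B c⁻¹) h3
        rwa [smul_smul, ← map_mul, inv_mul_cancel₀ hc0, map_one, one_smul] at h4
  · obtain ⟨s, hs⟩ := exists_sum_proj (𝒜 := 𝒜) b
    rw [← hs, Finset.sum_smul]
    refine sum_mem fun j _ => ?_
    by_cases hj : j < 1
    · rw [hb j hj, zero_smul]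
      exact I.zero_mem
    · by_contra hcon
      have h5 := hmem ((self 𝒜).smul_mem (proj_mem j b) hx) hcon
      have := hmax h5 (by omega)
      omega

end tail

section finiteness

variable [GradedAlgebra 𝒜] [IsConnectedGraded 𝒜]

/-- The map `B → B / I`, `b ↦ b x`. -/
def mulQuot (I : Submodule B B) (x : B) : B →ₗ[B] (B ⧸ I) := I.mkQ.comp (LinearMap.toSpanSingleton B B x)

theorem ker_mulQuot {I : Submodule B B} {x : B} (hx : ∀ b : B, b • x ∈ I ↔ b ∈ tail 𝒜 1) :
    LinearMap.ker (mulQuot I x) = tail 𝒜 1 := by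
  ext b
  rw [← hx b, LinearMap.mem_ker]
  exact Submodule.Quotient.mk_eq_zero I

theorem map_mkQ_sup (I : Submodule B B) (x : B) :
    (I ⊔ Submodule.span B {x}).map I.mkQ = LinearMap.range (mulQuot I x) := by
  rw [Submodule.map_sup, mulQuot, LinearMap.range_comp, LinearMap.range_toSpanSingleton]
  simp

/-- The ideal `B_{≥ 1}` is finitely generated. -/
theorem fg_tail_one [IsLeftGradedCoherent 𝒜] [HasTwistIdeal 𝒜] : (tail 𝒜 1).FG := by
  obtain ⟨I, hI, hfin, G, hG, ⟨e⟩⟩ := HasTwistIdeal.exists_ideal (𝒜 := 𝒜)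
  have hinv : Function.Surjective (lin e.inv) := surjective_of_epi e.inv
  have hIfin : Module.Finite B I := Module.Finite.of_surjective (lin e.inv) hinv
  have hIfg : I.FG := Module.Finite.iff_fg.1 hIfin
  have hne : I ≠ ⊤ := by
    intro htop
    have h1 : (1 : B) ∈ I := htop ▸ Submodule.mem_top
    have hnt : Nontrivial B := IsConnectedGraded.nontrivial (𝒜 := 𝒜)
    let y : B × G.carrier := lin e.hom (⟨1, h1⟩ : I)
    have hy : y.1 ∈ 𝒜 (-1 + 0) :=
      (lin_mem e.hom (i := 0) (m := (⟨1, h1⟩ : I)) (SetLike.one_mem_graded 𝒜)).1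
    rw [IsConnectedGraded.eq_bot_of_neg (𝒜 := 𝒜) _ (by norm_num), Submodule.mem_bot] at hy
    let u : I := lin e.inv ((1, 0) : B × G.carrier)
    have hu : lin e.hom u = ((1, 0) : B × G.carrier) := by
      change lin (e.inv ≫ e.hom) ((1, 0) : B × G.carrier) = _
      rw [e.inv_hom_id, lin_id]
    have hu' : u = u.1 • (⟨1, h1⟩ : I) := Subtype.ext (mul_one u.1).symm
    rw [hu', map_smul] at hu
    have h2 : u.1 • y.1 = 1 := congrArg Prod.fst hu
    rw [hy, smul_zero] at h2
    exact zero_ne_one h2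
  obtain ⟨d, x, hxd, hxI, hx⟩ := exists_mul_mem hI hne hfin
  let J := I ⊔ Submodule.span B {x}
  have hJ : (self 𝒜).IsGraded J := (self 𝒜).isGraded_sup hI ((self 𝒜).isGraded_span hxd)
  have hIJ : I ≤ J := le_sup_left
  have hJfp : Module.FinitePresentation B J :=
    IsLeftGradedCoherent.finitePresentation J hJ (hIfg.sup (Submodule.fg_span_singleton x))
  have hR : J.map I.mkQ = LinearMap.range (mulQuot I x) := map_mkQ_sup I x
  let q : J →ₗ[B] LinearMap.range (mulQuot I x) := (I.mkQ.comp J.subtype).codRestrict _ fun y => by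
    rw [← hR]; exact ⟨y, y.2, rfl⟩
  have hq : Function.Surjective q := by
    rintro ⟨r, hr⟩
    rw [← hR] at hr
    obtain ⟨y, hy, rfl⟩ := hr
    exact ⟨⟨y, hy⟩, rfl⟩
  have hqker : (LinearMap.ker q).FG := by
    have : LinearMap.ker q = LinearMap.range (Submodule.inclusion hIJ) := by
      ext y
      constructor
      · intro hy
        exact ⟨⟨y.1, (Submodule.Quotient.mk_eq_zero I).1 (congrArg Subtype.val hy)⟩, rfl⟩
      · rintro ⟨z, rfl⟩
        exact Subtype.ext ((Submodule.Quotient.mk_eq_zero I).2 z.2)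
    rw [this]
    exact Module.Finite.iff_fg.1 inferInstance
  have hRfp : Module.FinitePresentation B (LinearMap.range (mulQuot I x)) :=
    Module.finitePresentation_of_surjective q hq hqker
  have := Module.FinitePresentation.fg_ker (mulQuot I x).rangeRestrict
    (mulQuot I x).surjective_rangeRestrict
  rwa [LinearMap.ker_rangeRestrict, ker_mulQuot hx] at this

theorem fg_of_finite [IsLeftGradedCoherent 𝒜] [HasTwistIdeal 𝒜] (I : Submodule B B)
    (hI : (self 𝒜).IsGraded I) (hfin : Module.Finite k (B ⧸ I)) : I.FG := by
  induction hn : Module.finrank k (B ⧸ I) using Nat.strong_induction_on generalizing I with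
  | _ n ih =>
    by_cases hne : I = ⊤
    · subst hne
      exact Module.Finite.fg_top
    obtain ⟨d, x, hxd, hxI, hx⟩ := exists_mul_mem hI hne hfin
    let J := I ⊔ Submodule.span B {x}
    have hJ : (self 𝒜).IsGraded J := (self 𝒜).isGraded_sup hI ((self 𝒜).isGraded_span hxd)
    have hIJ : I ≤ J := le_sup_left
    have hxJ : x ∈ J := Submodule.mem_sup_right (Submodule.mem_span_singleton_self x)
    let p : (B ⧸ I) →ₗ[k] (B ⧸ J) := (Submodule.factor hIJ).restrictScalars k
    have hp : Function.Surjective p := Submodule.factor_surjective hIJ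
    have hfinJ : Module.Finite k (B ⧸ J) := Module.Finite.of_surjective p hp
    have hlt : Module.finrank k (B ⧸ J) < n := by
      rw [← hn]
      refine lt_of_le_of_ne (LinearMap.finrank_le_finrank_of_surjective hp) fun heq => hxI ?_
      have := (LinearMap.injective_iff_surjective_of_finrank_eq_finrank heq.symm).2 hp
      rw [← Submodule.Quotient.mk_eq_zero]
      refine this ?_
      rw [map_zero]
      exact (Submodule.Quotient.mk_eq_zero J).2 hxJ
    have hJfg : J.FG := ih _ hlt J hJ hfinJ rfl
    have : Module.Finite B J := Module.Finite.iff_fg.2 hJfg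
    let R := LinearMap.range (mulQuot I x)
    have : Module.FinitePresentation B R :=
      Module.finitePresentation_of_surjective (mulQuot I x).rangeRestrict
        (mulQuot I x).surjective_rangeRestrict (by
          rw [LinearMap.ker_rangeRestrict, ker_mulQuot hx]; exact fg_tail_one)
    have hR : J.map I.mkQ = R := map_mkQ_sup I x
    let q : J →ₗ[B] R := (I.mkQ.comp J.subtype).codRestrict R fun y => by
      rw [← hR]; exact ⟨y, y.2, rfl⟩
    have hq : Function.Surjective q := by
      rintro ⟨r, hr⟩
      rw [← hR] at hr
      obtain ⟨y, hy, rfl⟩ := hr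
      exact ⟨⟨y, hy⟩, rfl⟩
    have hker := Module.FinitePresentation.fg_ker q hq
    have : I = (LinearMap.ker q).map J.subtype := by
      ext y
      constructor
      · intro hy
        exact ⟨⟨y, hIJ hy⟩, Subtype.ext ((Submodule.Quotient.mk_eq_zero I).2 hy), rfl⟩
      · rintro ⟨z, hz, rfl⟩
        exact (Submodule.Quotient.mk_eq_zero I).1 (congrArg Subtype.val hz)
    rw [this]
    exact hker.map _

theorem fdim_of_exact [IsLeftGradedCoherent 𝒜] [HasTwistIdeal 𝒜] {X Y Z : GrMod 𝒜}
    (f : X ⟶ Y) (g : Y ⟶ Z) (hfg : LinearMap.ker (lin g) = LinearMap.range (lin f))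
    (hX : fdim 𝒜 X) (hZ : fdim 𝒜 Z) : fdim 𝒜 Y := by
  refine fdim_of_homogeneous fun d m hm => ?_
  refine ⟨Submodule.span B {m}, Y.isGraded_span hm, ?_, Submodule.mem_span_singleton_self m⟩
  let l : B →ₗ[B] Z.carrier := (lin g).comp (LinearMap.toSpanSingleton B _ m)
  let J : Submodule B B := LinearMap.ker l
  have hl : ∀ b, l b = b • lin g m := fun b => by simp [l]
  have hJ : (self 𝒜).IsGraded J := by
    intro b hb i
    rw [LinearMap.mem_ker, hl] at hb ⊢
    rw [comp_self, ← Z.comp_smul_of_mem (lin_mem g hm), hb, map_zero]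
  have hJfin : Module.Finite k (B ⧸ J) := by
    obtain ⟨N, hN, hNfin, hmN⟩ := hZ (lin g m)
    let l' : B →ₗ[B] N := l.codRestrict N fun b => by rw [hl]; exact N.smul_mem b hmN
    have hl' : LinearMap.ker l' = J := LinearMap.ker_codRestrict _ _ _
    let e : (B ⧸ J) →ₗ[B] N := J.liftQ l' hl'.ge
    have he : Function.Injective e := by
      rw [← LinearMap.ker_eq_bot]
      exact Submodule.ker_liftQ_eq_bot _ _ _ hl'.le
    exact Module.Finite.of_injective (e.restrictScalars k) he
  obtain ⟨S, hS⟩ := fg_of_finite J hJ hJfin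
  -- a finite-dimensional submodule of the image of `f` that contains `J m`
  have key : ∀ T : Finset B, (∀ b ∈ T, b ∈ J) → ∃ P : Submodule B Y.carrier, Module.Finite k P ∧
      ∀ b ∈ T, b • m ∈ P := by
    classical
    intro T
    induction T using Finset.induction_on with
    | empty => exact fun _ => ⟨⊥, inferInstance, by simp⟩
    | insert a T ha ih =>
      intro h
      obtain ⟨P, hP, hPT⟩ := ih fun b hb => h b (Finset.mem_insert_of_mem hb)
      have h1 : a • m ∈ LinearMap.ker (lin g) := by
        have := h a (Finset.mem_insert_self a T)
        rw [LinearMap.mem_ker, hl] at this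
        rw [LinearMap.mem_ker, map_smul, this]
      rw [hfg] at h1
      obtain ⟨x, hx⟩ := h1
      obtain ⟨Q, -, hQ, hxQ⟩ := (hX x).map f
      refine ⟨P ⊔ Q, finite_sup hP hQ, fun b hb => ?_⟩
      rcases Finset.mem_insert.1 hb with rfl | hb
      · exact Submodule.mem_sup_right (hx ▸ hxQ)
      · exact Submodule.mem_sup_left (hPT b hb)
  obtain ⟨P, hP, hPS⟩ := key S fun b hb => hS ▸ Submodule.subset_span hb
  let t : B →ₗ[B] (Y.carrier ⧸ P) := P.mkQ.comp (LinearMap.toSpanSingleton B _ m)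
  have ht : J ≤ LinearMap.ker t := by
    rw [← hS, Submodule.span_le]
    intro b hb
    exact (Submodule.Quotient.mk_eq_zero P).2 (hPS b hb)
  let t' : (B ⧸ J) →ₗ[k] (Y.carrier ⧸ P) := (J.liftQ t ht).restrictScalars k
  have h1 : (((Submodule.span B {m}).restrictScalars k).map (P.mkQ.restrictScalars k)).FG := by
    have : ((Submodule.span B {m}).restrictScalars k).map (P.mkQ.restrictScalars k) =
        LinearMap.range t' := by
      ext y
      constructor
      · rintro ⟨z, hz, rfl⟩
        obtain ⟨b, rfl⟩ := Submodule.mem_span_singleton.1 hz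
        exact ⟨Submodule.Quotient.mk b, rfl⟩
      · rintro ⟨z, rfl⟩
        obtain ⟨b, rfl⟩ := Submodule.mkQ_surjective J z
        exact ⟨b • m, Submodule.smul_mem _ b (Submodule.mem_span_singleton_self m), rfl⟩
    rw [this]
    exact Module.Finite.iff_fg.1 inferInstance
  have h2 : ((Submodule.span B {m}).restrictScalars k ⊓
      LinearMap.ker (P.mkQ.restrictScalars k)).FG := by
    have hk : LinearMap.ker (P.mkQ.restrictScalars k) = P.restrictScalars k := by
      ext y; exact Submodule.Quotient.mk_eq_zero P
    rw [hk]
    have : Module.Finite k (P.restrictScalars k) := hP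
    rw [← Module.Finite.iff_fg]
    exact Submodule.finiteDimensional_inf_right _ _
  exact Module.Finite.iff_fg.2 (Submodule.fg_of_fg_map_of_fg_inf_ker _ h1 h2)

instance isSerreClass_fdim [IsLeftGradedCoherent 𝒜] [HasTwistIdeal 𝒜] : (fdim 𝒜).IsSerreClass where
  exists_zero := ⟨zeroMod 𝒜, isZero_zeroMod, fun _ => isFdimElt_zero _⟩
  prop_of_mono f _ h := fun m => (h (lin f m)).of_map f (injective_of_mono f)
  prop_of_epi f _ h := fun m => by
    obtain ⟨m, rfl⟩ := surjective_of_epi f m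
    exact (h m).map f
  prop_X₂_of_shortExact {S} hS h₁ h₃ := by
    have := hS.mono_f
    refine fdim_of_exact S.f S.g (le_antisymm (fun m hm => ?_) ?_) h₁ h₃
    · let i := hS.fIsKernel.lift (KernelFork.ofι (f := S.g) (S.X₂.incl _ (isGraded_ker S.g))
        (hom_ext fun m => m.2))
      have hi : i ≫ S.f = S.X₂.incl _ (isGraded_ker S.g) := hS.fIsKernel.fac _ WalkingParallelPair.zero
      exact ⟨lin i (⟨m, hm⟩ : LinearMap.ker (lin S.g)),
        congrArg (fun h => lin h (⟨m, hm⟩ : LinearMap.ker (lin S.g))) hi⟩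
    · rintro _ ⟨x, rfl⟩
      exact congrArg (fun h => lin h x) S.zero

end finiteness

/-! ### The quotient category `QGr B = Gr B / Fdim B` -/

section quotient

variable [(fdim 𝒜).IsSerreClass]

theorem fdim_kernel_iff {M N : GrMod 𝒜} (f : M ⟶ N) :
    fdim 𝒜 (kernel f) ↔ ∀ m, lin f m = 0 → M.IsFdimElt m := by
  let e : kernel f ≅ M.ofSub _ (isGraded_ker f) := (kernelIsKernel f).conePointUniqueUpToIso (isLimitKer f)
  rw [(fdim 𝒜).prop_iff_of_iso e]
  have hinj : Function.Injective (lin (M.incl _ (isGraded_ker f))) := Subtype.val_injective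
  exact ⟨fun h m hm => (h ⟨m, hm⟩).map (M.incl _ (isGraded_ker f)),
    fun h m => (h m.1 m.2).of_map (M.incl _ (isGraded_ker f)) hinj⟩

/-- A morphism in the quotient category from `M` to `N` is given by a morphism `M' → N / N'`
where `M / M'` and `N'` are in `Fdim B`; in particular there is only a `u`-small set of them. -/
theorem small_hom (M N : GrMod 𝒜) :
    Small.{u} ((fdim 𝒜).isoModSerre.Q.obj M ⟶ (fdim 𝒜).isoModSerre.Q.obj N) := by
  classical
  let W := (fdim 𝒜).isoModSerre
  have hW := Localization.inverts W.Q W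
  let T := Σ (P : {P : Submodule B M.carrier // M.IsGraded P})
    (K : {K : Submodule B N.carrier // N.IsGraded K}), (M.ofSub P.1 P.2 ⟶ N.quot K.1 K.2)
  let F : T → (W.Q.obj M ⟶ W.Q.obj N) := fun t =>
    if h : W (M.incl t.1.1 t.1.2) ∧ W (N.proj t.2.1.1 t.2.1.2) then
      haveI := hW _ h.1
      haveI := hW _ h.2
      inv (W.Q.map (M.incl t.1.1 t.1.2)) ≫ W.Q.map t.2.2 ≫ inv (W.Q.map (N.proj t.2.1.1 t.2.1.2))
    else W.Q.map 0
  refine small_of_surjective (f := F) fun φ => ?_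
  obtain ⟨⟨s, hs, f⟩, rfl⟩ := Localization.exists_rightFraction W.Q W φ
  rename_i X
  let P : Submodule B M.carrier := LinearMap.range (lin s)
  let K : Submodule B N.carrier := (LinearMap.ker (lin s)).map (lin f)
  have hP : M.IsGraded P := isGraded_range s
  have hK : N.IsGraded K := isGraded_map f (isGraded_ker s)
  let e : X ⟶ M.ofSub P hP := homMk (N := M.ofSub P hP) (lin s).rangeRestrict fun i x hx => lin_mem s hx
  have he : Function.Surjective (lin e) := (lin s).surjective_rangeRestrict
  have hes : e ≫ M.incl P hP = s := rfl
  have hker : LinearMap.ker (lin e) = LinearMap.ker (lin s) := LinearMap.ker_rangeRestrict _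
  obtain ⟨g, hg⟩ := exists_desc e he (f ≫ N.proj K hK) (by
    intro x hx
    rw [hker] at hx
    exact (Submodule.Quotient.mk_eq_zero K).2 ⟨x, hx, rfl⟩)
  have hsker : ∀ x, lin s x = 0 → X.IsFdimElt x := (fdim_kernel_iff s).1 hs.1
  have := epi_of_surjective e he
  have heW : W e := (fdim 𝒜).isoModSerre_of_epi e ((fdim_kernel_iff e).2 fun x hx => hsker x (by
    rw [← LinearMap.mem_ker, ← hker]; exact hx))
  have hiW : W (M.incl P hP) := W.of_precomp e _ heW (by rw [hes]; exact hs)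
  have hq : Function.Surjective (lin (N.proj K hK)) := Submodule.mkQ_surjective K
  have := epi_of_surjective _ hq
  have hqW : W (N.proj K hK) := (fdim 𝒜).isoModSerre_of_epi _ ((fdim_kernel_iff _).2 fun y hy => by
    obtain ⟨x, hx, rfl⟩ : y ∈ K := (Submodule.Quotient.mk_eq_zero K).1 hy
    exact (hsker x hx).map f)
  refine ⟨⟨⟨P, hP⟩, ⟨K, hK⟩, g⟩, ?_⟩
  have h1 := hW _ hiW
  have h2 := hW _ hqW
  have h3 := hW _ heW
  have h4 := hW _ hs
  have hF : F ⟨⟨P, hP⟩, ⟨K, hK⟩, g⟩ =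
      inv (W.Q.map (M.incl P hP)) ≫ W.Q.map g ≫ inv (W.Q.map (N.proj K hK)) :=
    dif_pos ⟨hiW, hqW⟩
  have hes' : W.Q.map e ≫ W.Q.map (M.incl P hP) = W.Q.map s := by
    rw [← W.Q.map_comp]
    exact congrArg _ hes
  rw [hF, IsIso.inv_comp_eq, IsIso.comp_inv_eq, ← cancel_epi (W.Q.map e), ← W.Q.map_comp, hg,
    W.Q.map_comp, ← Category.assoc, ← Category.assoc, hes']
  exact congrArg (fun h => h ≫ W.Q.map (N.proj K hK))
    ((MorphismProperty.RightFraction.mk s hs f).map_s_comp_map W.Q hW).symm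

instance locallySmall_localization : LocallySmall.{u} (fdim 𝒜).isoModSerre.Localization where
  hom_small X Y := by
    have := Localization.essSurj (fdim 𝒜).isoModSerre.Q (fdim 𝒜).isoModSerre
    let L := (fdim 𝒜).isoModSerre.Q
    have := small_hom (L.objPreimage X) (L.objPreimage Y)
    exact small_map (Iso.homCongr (L.objObjPreimageIso X) (L.objObjPreimageIso Y)).symm

variable (𝒜) in
/-- The localization of `Gr B` at the morphisms with kernel and cokernel in `Fdim B`, with its
morphism sets replaced by isomorphic copies in the universe of `B`. -/
noncomputable instance hasLocalization : (fdim 𝒜).isoModSerre.HasLocalization :=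
  (fdim 𝒜).isoModSerre.hasLocalizationOfLocallySmall (fdim 𝒜).isoModSerre.Q

variable (𝒜) in
/-- The category `QGr B`, the quotient of `Gr B` by the Serre subcategory `Fdim B`. -/
abbrev QGr := (fdim 𝒜).isoModSerre.Localization'

variable (𝒜) in
/-- The quotient functor `β^* : Gr B ⥤ QGr B`. -/
noncomputable abbrev toQGr : GrMod 𝒜 ⥤ QGr 𝒜 := (fdim 𝒜).isoModSerre.Q'

variable (𝒜) in
/-- The object `𝒪 = β^* B` of `QGr B`. -/
noncomputable abbrev structureSheaf [GradedAlgebra 𝒜] : QGr 𝒜 := (toQGr 𝒜).obj (self 𝒜)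

end quotient

/-- A progenerator: a finitely generated projective generator. -/
structure IsProgenerator {C : Type*} [Category C] (P : C) : Prop where
  projective : Projective P
  isSeparator : IsSeparator P
  /-- If `P` is the sum of a directed family of subobjects, then it is one of them. -/
  finitelyGenerated : ∀ S : Set (Subobject P), S.Nonempty → DirectedOn (· ≤ ·) S → IsLUB S ⊤ → ⊤ ∈ S

section endTail

variable (𝒜) [GradedAlgebra 𝒜] [IsConnectedGraded 𝒜]

/-- The graded left module `B_{≥ n}`. -/
abbrev tailMod (n : ℤ) : GrMod 𝒜 := (self 𝒜).ofSub (tail 𝒜 n) (isGraded_tail 𝒜 n)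

variable {𝒜}

theorem lin_mem_tail {n m : ℕ} (f : tailMod 𝒜 n ⟶ tailMod 𝒜 n) (x : tail 𝒜 n)
    (hx : x.1 ∈ tail 𝒜 m) : (lin f x).1 ∈ tail 𝒜 m := by
  intro i hi
  have h := comp_lin (f ≫ (self 𝒜).incl _ (isGraded_tail 𝒜 n)) i x
  have h0 : (tailMod 𝒜 n).comp i x = 0 := by
    have h1 := comp_lin ((self 𝒜).incl _ (isGraded_tail 𝒜 n)) i x
    refine Subtype.ext (h1.symm.trans ?_)
    rw [comp_self]
    exact hx i hi
  rw [h0, map_zero, comp_self] at h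
  exact h

theorem tail_le {n m : ℕ} (h : n ≤ m) : tail 𝒜 (m : ℤ) ≤ tail 𝒜 (n : ℤ) :=
  fun _ hb i hi => hb i (by omega)

variable (𝒜) in
/-- The restriction map `End(B_{≥ n}) → End(B_{≥ m})` for `n ≤ m`. -/
def restrictEnd {n m : ℕ} (h : n ≤ m) : End (tailMod 𝒜 n) →ₐ[k] End (tailMod 𝒜 m) :=
  AlgHom.ofLinearMap
    { toFun := fun f => homMk (M := tailMod 𝒜 m) (N := tailMod 𝒜 m)
        ((((tail 𝒜 n).subtype.comp (lin f)).comp (Submodule.inclusion (tail_le h))).codRestrict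
          (tail 𝒜 m) fun x => lin_mem_tail f _ x.2)
        fun i x hx => lin_mem f (m := Submodule.inclusion (tail_le h) x) hx
      map_add' := fun f g => rfl
      map_smul' := fun c f => rfl }
    rfl (fun f g => rfl)

instance directedSystem_restrictEnd :
    DirectedSystem (fun n : ℕ => End (tailMod 𝒜 n)) (fun _ _ h => restrictEnd 𝒜 h) where
  map_self _ _ := rfl
  map_map _ _ _ _ _ _ := rfl

variable (𝒜) in
/-- The direct limit of the `k`-algebras `End(B_{≥ n})` along the restriction maps. -/
abbrev limEnd : Type u :=
  DirectLimit (fun n : ℕ => End (tailMod 𝒜 n)) (fun _ _ h => restrictEnd 𝒜 h)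

end endTail

end NCProj

/-! Everything rests on one description of the morphisms `𝒪 ⟶ β^* M`
(`HasProjectiveIdeals.exists_map_eq`). Such a morphism is a right fraction `B ← X → M`, and the
image of `X` in `B` is a graded left ideal of finite codimension. By (c) it contains a graded ideal
`J`, again of finite codimension, that is projective; the inclusion of `J` therefore lifts to `X`,
and the fraction is replaced by an honest graded map `J → M`. Lifting this map along epimorphisms of
`Gr B` shows that `𝒪` is projective.

Hypothesis (a) and hypothesis (b) make every graded left ideal of finite codimension finitely
generated (`fg_of_finite`). Hence `Fdim B` is closed under extensions, each `B_{≥ n}` has finite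
codimension, and the `J` above is finitely generated, so that a map from `J` to a direct sum meets
only finitely many summands. This is the compactness of `𝒪`.

Iterating (b) gives ideals of finite codimension that surject onto `B(-d)`, for every `d ≥ 0`. Since
these ideals represent `𝒪`, morphisms out of `𝒪` detect homogeneous elements of degree `d ≥ 0`. An
element of negative degree is moved to degrees `≥ 0` by some `B_{≥ n}`, which suffices modulo
torsion. So `𝒪` is a separator (`isSeparator_structureSheaf`).

A Gabriel–Mitchell argument (`isEquivalence_preadditiveCoyonedaObj`) turns a projective separator
with compact powers into an equivalence with modules.

For the endomorphism ring, every `J` contains some `B_{≥ n}`, and a degree-preserving map `B_{≥ n} →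
B` lands in `B_{≥ n}`; so the maps `End(B_{≥ n}) → End(𝒪)` are jointly surjective. They are
injective once `B` has no torsion, which is what the free right submodules of the `B_{≥ n}` provide
(`eq_zero_of_isFdimElt_self`). -/

namespace CategoryTheory

/-! ### Gabriel–Mitchell theorem for a projective separator with compact powers -/

section compactProjective

universe w

variable {C : Type*} [Category.{w} C] [Abelian C] {P : C}

theorem IsSeparator.eq_zero (hP : IsSeparator P) {X Y : C} {f : X ⟶ Y} (h : ∀ x : P ⟶ X, x ≫ f = 0) : f = 0 :=
  (Preadditive.isSeparator_iff P).1 hP f h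

/-- `ι : K → (P ⟶ S)` is a weak coproduct of copies of `P`, and morphisms from `P` into it
are finite combinations of the `ι i`. -/
structure IsCompactPower {C : Type*} [Category.{w} C] [Preadditive C] {P S : C} {K : Type w}
    (ι : K → (P ⟶ S)) : Prop where
  exists_desc : ∀ {Y : C} (y : K → (P ⟶ Y)), ∃ g : S ⟶ Y, ∀ i, ι i ≫ g = y i
  span_eq_top : Submodule.span (End P)ᵐᵒᵖ (Set.range ι) = ⊤

/-- The weak universal property gives a projection of `S` onto its `j`-th copy of `P`; composing a
relation with it leaves only the `j`-th coefficient. -/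
theorem IsCompactPower.linearIndependent {S : C} {K : Type w} {ι : K → (P ⟶ S)}
    (hι : IsCompactPower ι) : LinearIndependent (End P)ᵐᵒᵖ ι := by
  classical
  rw [linearIndependent_iff]
  intro l hl
  ext j
  obtain ⟨g, hg⟩ := hι.exists_desc (fun i => if i = j then 𝟙 P else 0)
  have h := congrArg (((preadditiveCoyonedaObj P).map g).hom) hl
  erw [map_zero, Finsupp.apply_linearCombination] at h
  rw [Finsupp.linearCombination_apply, Finsupp.sum_eq_single j] at h
  · change (l j).unop ≫ ι j ≫ g = 0 at h
    rw [hg, if_pos rfl, Category.comp_id] at h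
    exact congrArg MulOpposite.op h
  · intro i _ hi
    change (l i).unop ≫ ι i ≫ g = 0
    rw [hg, if_neg hi, comp_zero]
  · intro _
    exact zero_smul _ _

/-- Cover `X` by the power of `P` indexed by all `x : P ⟶ X`, with `p` evaluating each `x` and `q`
evaluating each `φ x`. Spanning gives `t ≫ q = φ (t ≫ p)` for every `t`, so `q` kills the kernel of
`p`; as `p` is epi, `q` descends to a preimage of `φ`. -/
theorem full_preadditiveCoyonedaObj_of_isSeparator (hP : IsSeparator P)
    (h : ∀ K : Type w, ∃ (S : C) (ι : K → (P ⟶ S)), IsCompactPower ι) :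
    (preadditiveCoyonedaObj P).Full where
  map_surjective {X Y} φ := by
    obtain ⟨S, ι, hι⟩ := h (P ⟶ X)
    obtain ⟨p, hp⟩ := hι.exists_desc (fun x => x)
    obtain ⟨q, hq⟩ := hι.exists_desc (fun x => φ.hom x)
    have hpq : ∀ t : P ⟶ S, t ≫ q = φ.hom (t ≫ p) := by
      intro t
      have := LinearMap.ext_on_range hι.span_eq_top
        (f := ((preadditiveCoyonedaObj P).map q).hom)
        (g := φ.hom.comp ((preadditiveCoyonedaObj P).map p).hom) fun x => by
          change ι x ≫ q = φ.hom (ι x ≫ p)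
          rw [hq, hp]
      exact LinearMap.congr_fun this t
    have hepi : Epi p := Preadditive.epi_of_cancel_zero _ fun f hf => hP.eq_zero fun x => by
      rw [← hp x, Category.assoc, hf, comp_zero]
    have hker : kernel.ι p ≫ q = 0 := hP.eq_zero fun t => by
      rw [← Category.assoc, hpq, Category.assoc, kernel.condition, comp_zero]
      exact map_zero φ.hom
    refine ⟨Abelian.epiDesc p q hker, ?_⟩
    ext x
    change x ≫ _ = φ.hom x
    exact (congrArg (· ≫ Abelian.epiDesc p q hker) (hp x)).symm.trans
      ((Category.assoc _ _ _).trans ((congrArg (ι x ≫ ·) (Abelian.comp_epiDesc p q hker)).trans (hq x)))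

/-- A presentation of `N` by free modules is realised by a map `d` between powers of `P`. Since `P`
is projective, `Hom(P, -)` carries the cokernel of `d` to `N`. -/
theorem essSurj_preadditiveCoyonedaObj_of_projective [Projective P]
    (h : ∀ K : Type w, ∃ (S : C) (ι : K → (P ⟶ S)), IsCompactPower ι) :
    (preadditiveCoyonedaObj P).EssSurj where
  mem_essImage N := by
    obtain ⟨S, ι, hι⟩ := h N
    let b : Module.Basis N (End P)ᵐᵒᵖ (P ⟶ S) := Module.Basis.mk hι.linearIndependent hι.span_eq_top.ge
    let ψ : (P ⟶ S) →ₗ[(End P)ᵐᵒᵖ] N := b.constr ℤ id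
    have hψ : ∀ n, ψ (ι n) = n := fun n => by
      have h1 := b.constr_basis ℤ (id : N → N) n
      rwa [Module.Basis.mk_apply] at h1
    obtain ⟨T, κ, hκ⟩ := h (LinearMap.ker ψ)
    obtain ⟨d, hd⟩ := hκ.exists_desc (fun t => t.1)
    let π : (P ⟶ S) →ₗ[(End P)ᵐᵒᵖ] (P ⟶ cokernel d) :=
      ((preadditiveCoyonedaObj P).map (cokernel.π d)).hom
    have hπs : Function.Surjective π := fun x =>
      ⟨Projective.factorThru x (cokernel.π d), Projective.factorThru_comp _ _⟩
    have hψs : Function.Surjective ψ := fun n => ⟨_, hψ n⟩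
    -- `ψ` and `π` are surjections from the same module, so equal kernels give isomorphic targets.
    -- Both kernels are the image of `Hom(P, T)` under `d`: for `π` by projectivity, for `ψ` because
    -- the copies of `P` in `T` are indexed by `ker ψ`.
    have hker : LinearMap.ker ψ = LinearMap.ker π := by
      ext t
      constructor
      · intro ht
        change t ≫ cokernel.π d = 0
        have h1 : κ ⟨t, ht⟩ ≫ d = t := hd ⟨t, ht⟩
        rw [← h1, Category.assoc, cokernel.condition, comp_zero]
      · intro ht
        have hex : (ShortComplex.mk d (cokernel.π d) (cokernel.condition d)).Exact :=
          ShortComplex.exact_cokernel d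
        obtain ⟨s, rfl⟩ : ∃ s, s ≫ d = t :=
          ⟨hex.liftFromProjective t ht, hex.liftFromProjective_comp t ht⟩
        have := LinearMap.ext_on_range hκ.span_eq_top
          (f := ψ.comp ((preadditiveCoyonedaObj P).map d).hom) (g := 0) fun x => by
            change ψ (κ x ≫ d) = 0
            rw [hd]
            exact x.2
        exact LinearMap.congr_fun this s
    exact ⟨cokernel d, ⟨LinearEquiv.toModuleIso ((π.quotKerEquivOfSurjective hπs).symm ≪≫ₗ
      Submodule.quotEquivOfEq _ _ hker.symm ≪≫ₗ ψ.quotKerEquivOfSurjective hψs)⟩⟩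

theorem isEquivalence_preadditiveCoyonedaObj [Projective P] (hP : IsSeparator P)
    (h : ∀ K : Type w, ∃ (S : C) (ι : K → (P ⟶ S)), IsCompactPower ι) :
    (preadditiveCoyonedaObj P).IsEquivalence where
  faithful := (isSeparator_iff_faithful_preadditiveCoyonedaObj P).1 hP
  full := full_preadditiveCoyonedaObj_of_isSeparator hP h
  essSurj := essSurj_preadditiveCoyonedaObj_of_projective h

end compactProjective

end CategoryTheory

namespace NCProj

variable {k B : Type u} [Field k] [Ring B] [Algebra k B] {𝒜 : ℤ → Submodule k B}

namespace GrMod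

/-! ### Torsion and finite-dimensional modules -/

/-- The submodule of the elements lying in a finite-dimensional graded submodule. -/
def torsion (M : GrMod 𝒜) : Submodule B M.carrier where
  carrier := {m | M.IsFdimElt m}
  add_mem' h h' := h.add h'
  zero_mem' := M.isFdimElt_zero
  smul_mem' b _ := fun ⟨N, hN, hf, hm⟩ => ⟨N, hN, hf, N.smul_mem b hm⟩

theorem isGraded_torsion (M : GrMod 𝒜) : M.IsGraded M.torsion :=
  fun _ ⟨N, hN, hf, hm⟩ i => ⟨N, hN, hf, hN _ hm i⟩

theorem injective_incl (M : GrMod 𝒜) (N : Submodule B M.carrier) (hN : M.IsGraded N) :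
    Function.Injective (lin (M.incl N hN)) := Subtype.val_injective

theorem surjective_proj (M : GrMod 𝒜) (N : Submodule B M.carrier) (hN : M.IsGraded N) :
    Function.Surjective (lin (M.proj N hN)) := Submodule.mkQ_surjective N

instance mono_incl (M : GrMod 𝒜) (N : Submodule B M.carrier) (hN : M.IsGraded N) :
    Mono (M.incl N hN) := mono_of_injective _ (M.injective_incl N hN)

theorem fdim_ofSub_iff (M : GrMod 𝒜) (N : Submodule B M.carrier) (hN : M.IsGraded N) :
    fdim 𝒜 (M.ofSub N hN) ↔ N ≤ M.torsion :=
  ⟨fun h m hm => (h ⟨m, hm⟩).map (M.incl N hN),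
    fun h m => IsFdimElt.of_map (M.incl N hN) (M.injective_incl N hN) (h m.2)⟩

theorem isGraded_top (M : GrMod 𝒜) : M.IsGraded ⊤ := fun _ _ _ => trivial

theorem fdim_of_finite {M : GrMod 𝒜} (h : Module.Finite k M.carrier) : fdim 𝒜 M := fun m =>
  ⟨⊤, M.isGraded_top, Module.Finite.of_surjective
    ((Submodule.topEquiv (R := B) (M := M.carrier)).symm.toLinearMap.restrictScalars k)
    (Submodule.topEquiv (R := B) (M := M.carrier)).symm.surjective, trivial⟩

theorem exists_finite_of_subset_torsion (M : GrMod 𝒜) (S : Finset M.carrier)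
    (hS : ∀ m ∈ S, M.IsFdimElt m) :
    ∃ P : Submodule B M.carrier, Module.Finite k P ∧ ∀ m ∈ S, m ∈ P := by
  classical
  induction S using Finset.induction_on with
  | empty => exact ⟨⊥, inferInstance, by simp⟩
  | insert a S ha ih =>
    obtain ⟨P, hP, hPS⟩ := ih fun m hm => hS m (Finset.mem_insert_of_mem hm)
    obtain ⟨Q, -, hQ, haQ⟩ := hS a (Finset.mem_insert_self a S)
    refine ⟨P ⊔ Q, finite_sup hP hQ, fun m hm => ?_⟩
    rcases Finset.mem_insert.1 hm with rfl | hm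
    · exact Submodule.mem_sup_right haQ
    · exact Submodule.mem_sup_left (hPS m hm)

theorem finite_of_fdim {M : GrMod 𝒜} (hfg : Module.Finite B M.carrier) (h : fdim 𝒜 M) :
    Module.Finite k M.carrier := by
  obtain ⟨S, hS⟩ := hfg.fg_top
  obtain ⟨P, hP, hPS⟩ := M.exists_finite_of_subset_torsion S fun m _ => h m
  have : P = ⊤ := top_le_iff.1 (hS ▸ Submodule.span_le.2 hPS)
  subst this
  exact Module.Finite.of_surjective ((Submodule.topEquiv (R := B)).toLinearMap.restrictScalars k)
    (Submodule.topEquiv (R := B)).surjective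

/-! ### Ideals of finite codimension, degree-zero parts, graded projectivity -/

section algebra

variable [GradedAlgebra 𝒜]

/-- `B ⧸ I` is cyclic, and a finite-dimensional submodule containing a generator is everything. -/
theorem fdim_quot_self_iff (I : Submodule B B) (hI : (self 𝒜).IsGraded I) :
    fdim 𝒜 ((self 𝒜).quot I hI) ↔ Module.Finite k (B ⧸ I) :=
  ⟨fun h => finite_of_fdim (M := (self 𝒜).quot I hI)
    (Module.Finite.of_surjective I.mkQ I.mkQ_surjective) h,
    fun h => fdim_of_finite (M := (self 𝒜).quot I hI) h⟩

/-- The morphism `I → M`, `b ↦ l b • m`, where `l : I → B` lowers degrees by `d` and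
`m` is homogeneous of degree `d`. -/
def smulMap (I : Submodule B B) (hI : (self 𝒜).IsGraded I) (d : ℤ) (l : I →ₗ[B] B)
    (hl : ∀ i, ∀ x : I, x.1 ∈ 𝒜 i → l x ∈ 𝒜 (i - d)) (M : GrMod 𝒜) (m : M.carrier)
    (hm : m ∈ M.grading d) : (self 𝒜).ofSub I hI ⟶ M :=
  homMk (M := (self 𝒜).ofSub I hI) ((LinearMap.toSpanSingleton B _ m).comp l) fun i x hx => by
    have h := M.smul_mem (hl i x hx) hm
    rwa [sub_add_cancel] at h

/-- A linear map between graded modules, restricted to its part of degree zero. -/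
theorem exists_degreeZero (M N : GrMod 𝒜) (l : M.carrier →ₗ[B] N.carrier) :
    ∃ f : M ⟶ N, ∀ i, ∀ m ∈ M.grading i, lin f m = N.comp i (l m) := by
  classical
  let := M.isInternal.chooseDecomposition
  -- On the degree `i` component of `M`, keep only the degree `i` component of `l`.
  let g : M.carrier →ₗ[k] N.carrier :=
    (DirectSum.toModule k ℤ N.carrier fun i =>
      N.comp i ∘ₗ (l.restrictScalars k) ∘ₗ (M.grading i).subtype) ∘ₗ
      (DirectSum.decomposeLinearEquiv M.grading).toLinearMap
  have hg : ∀ i, ∀ m ∈ M.grading i, g m = N.comp i (l m) := by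
    intro i m hm
    change DirectSum.toModule k ℤ N.carrier _ (DirectSum.decompose M.grading m) = _
    rw [DirectSum.decompose_of_mem M.grading hm]
    exact DirectSum.toModule_lof k i _
  have hsmul : ∀ (b : B) (m : M.carrier), g (b • m) = b • g m := by
    intro b m
    obtain ⟨s, hs⟩ := exists_sum_proj (𝒜 := 𝒜) b
    obtain ⟨t, ht⟩ := M.exists_sum_comp m
    rw [← hs, ← ht, Finset.sum_smul, Finset.sum_smul, map_sum]
    refine Finset.sum_congr rfl fun j _ => ?_
    rw [Finset.smul_sum, map_sum, map_sum, Finset.smul_sum]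
    refine Finset.sum_congr rfl fun i _ => ?_
    rw [hg i _ (M.comp_mem i m), hg (j + i) _ (M.smul_mem (proj_mem j b) (M.comp_mem i m)),
      map_smul, N.comp_smul_of_mem_left (proj_mem j b)]
  refine ⟨homMk { toFun := g, map_add' := map_add g, map_smul' := hsmul } fun i m hm => ?_, hg⟩
  have := hg i m hm
  change g m ∈ _
  rw [this]
  exact N.comp_mem i _

/-- Graded modules that are projective as modules are projective in `Gr B`. -/
theorem exists_lift_of_projective (P : GrMod 𝒜) [Module.Projective B P.carrier] {X Y : GrMod 𝒜}
    (e : X ⟶ Y) (he : Function.Surjective (lin e)) (f : P ⟶ Y) : ∃ g : P ⟶ X, g ≫ e = f := by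
  -- `l` need not preserve degrees, but `e` and `f` do, so the degree-zero part of `l` is still a
  -- lift.
  obtain ⟨l, hl⟩ := Module.projective_lifting_property (lin e) (lin f) he
  obtain ⟨g, hg⟩ := exists_degreeZero P X l
  refine ⟨g, hom_ext fun m => ?_⟩
  have key : ∀ i, ∀ m ∈ P.grading i, lin e (lin g m) = lin f m := fun i m hm => by
    rw [hg i m hm, ← comp_lin, ← LinearMap.comp_apply, hl, Y.comp_of_mem (lin_mem f hm)]
  obtain ⟨s, hs⟩ := P.exists_sum_comp m
  rw [lin_comp, ← hs]
  simp only [map_sum]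
  exact Finset.sum_congr rfl fun i _ => key i _ (P.comp_mem i m)

end algebra

theorem finite_quotient_of_sup_eq_top {X : Type*} [AddCommGroup X] [Module k X] [Module B X]
    [IsScalarTower k B X] (N : Submodule B X) {V : Submodule k X} (hV : V.FG)
    (h : V ⊔ N.restrictScalars k = ⊤) : Module.Finite k (X ⧸ N) := by
  have : Module.Finite k V := Module.Finite.iff_fg.2 hV
  refine Module.Finite.of_surjective ((N.mkQ.restrictScalars k).comp V.subtype) fun x => ?_
  obtain ⟨b, rfl⟩ := Submodule.mkQ_surjective _ x
  obtain ⟨v, hv, t, ht, rfl⟩ := Submodule.mem_sup.1 (h ▸ Submodule.mem_top : b ∈ V ⊔ _)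
  refine ⟨⟨v, hv⟩, ?_⟩
  have h0 : N.mkQ t = 0 := (Submodule.Quotient.mk_eq_zero N).2 ht
  rw [map_add, h0, add_zero]
  rfl

section connected

variable [GradedAlgebra 𝒜] [IsConnectedGraded 𝒜]

/-- A finite-dimensional graded quotient has only finitely many nonzero degrees. -/
theorem exists_tail_le {J : Submodule B B} (hJ : (self 𝒜).IsGraded J)
    (hfin : Module.Finite k (B ⧸ J)) : ∃ n : ℕ, tail 𝒜 (n : ℤ) ≤ J := by
  have hS : {i | ((self 𝒜).quot J hJ).grading i ≠ ⊥}.Finite :=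
    WellFoundedGT.finite_ne_bot_of_iSupIndep ((self 𝒜).quot J hJ).isInternal.submodule_iSupIndep
  obtain ⟨N, hN⟩ := hS.bddAbove
  -- `N` bounds the nonzero degrees of `B ⧸ J`, so everything in degrees `≥ N + 1` lies in `J`; if
  -- `N + 1` is negative, `toNat` only raises the bound.
  refine ⟨(N + 1).toNat, fun b hb => (self 𝒜).mem_of_comp_mem J fun i => ?_⟩
  rw [comp_self]
  by_cases hi : i < ((N + 1).toNat : ℤ)
  · rw [hb i hi]
    exact J.zero_mem
  · by_contra hcon
    refine absurd (hN (show i ∈ _ from fun h => hcon ?_)) (by omega)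
    have h1 : J.mkQ (GradedAlgebra.proj 𝒜 i b) ∈ ((self 𝒜).quot J hJ).grading i :=
      ⟨_, proj_mem i b, rfl⟩
    rw [h, Submodule.mem_bot] at h1
    exact (Submodule.Quotient.mk_eq_zero J).1 h1

end connected

/-! ### Torsion is closed under extensions -/

section coherent

variable [GradedAlgebra 𝒜] [IsConnectedGraded 𝒜] [IsLeftGradedCoherent 𝒜] [HasTwistIdeal 𝒜]

/-- Torsion elements of the quotient by the torsion submodule vanish. -/
theorem isFdimElt_of_proj_torsion {M : GrMod 𝒜} {m : M.carrier}
    (h : (M.quot M.torsion M.isGraded_torsion).IsFdimElt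
      (lin (M.proj M.torsion M.isGraded_torsion) m)) : M.IsFdimElt m := by
  let p := M.proj M.torsion M.isGraded_torsion
  let T := (M.quot M.torsion M.isGraded_torsion).torsion
  -- `N` is an extension of the torsion of `M ⧸ torsion` by the torsion of `M`, so `fdim_of_exact`
  -- puts it in `Fdim B`.
  let N := T.comap (lin p)
  have hT := (M.quot M.torsion M.isGraded_torsion).isGraded_torsion
  have hN : M.IsGraded N := isGraded_comap p hT
  have hle : M.torsion ≤ N := fun x hx => (show IsFdimElt _ _ from hx).map p
  let f : M.ofSub M.torsion M.isGraded_torsion ⟶ M.ofSub N hN :=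
    homMk (M := M.ofSub M.torsion M.isGraded_torsion) (N := M.ofSub N hN)
      (Submodule.inclusion hle) fun _ _ hx => hx
  let g : M.ofSub N hN ⟶ GrMod.ofSub _ T hT :=
    homMk (M := M.ofSub N hN) (N := GrMod.ofSub _ T hT)
      (((lin p).comp N.subtype).codRestrict T fun x => x.2) fun i x hx => lin_mem p hx
  have hfd : fdim 𝒜 (M.ofSub N hN) := by
    refine fdim_of_exact f g ?_ ((fdim_ofSub_iff _ _ _).2 le_rfl) ((fdim_ofSub_iff _ _ _).2 le_rfl)
    ext x
    constructor
    · intro hx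
      exact ⟨⟨x.1, (Submodule.Quotient.mk_eq_zero _).1 (congrArg Subtype.val hx)⟩, rfl⟩
    · rintro ⟨y, rfl⟩
      exact Subtype.ext ((Submodule.Quotient.mk_eq_zero _).2 y.2)
  exact (fdim_ofSub_iff M N hN).1 hfd h

/-- Modulo torsion, `I` annihilates `m`, so the image of `m` generates a quotient of the
finite-dimensional `B ⧸ I`; torsion modulo torsion is torsion. -/
theorem isFdimElt_of_forall_smul {M : GrMod 𝒜} {I : Submodule B B} (hI : (self 𝒜).IsGraded I)
    (hfin : Module.Finite k (B ⧸ I)) {d : ℤ} {m : M.carrier} (hm : m ∈ M.grading d)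
    (h : ∀ b ∈ I, M.IsFdimElt (b • m)) : M.IsFdimElt m := by
  refine isFdimElt_of_proj_torsion ?_
  let p := M.proj M.torsion M.isGraded_torsion
  refine ⟨Submodule.span B {lin p m}, isGraded_span _ (lin_mem p hm), ?_,
    Submodule.mem_span_singleton_self _⟩
  let l : B →ₗ[B] (M.quot M.torsion M.isGraded_torsion).carrier :=
    LinearMap.toSpanSingleton B _ (lin p m)
  have hl : I ≤ LinearMap.ker l := fun b hb => by
    change b • lin p m = 0
    rw [← map_smul]
    exact (Submodule.Quotient.mk_eq_zero _).2 (h b hb)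
  have hr : LinearMap.range (I.liftQ l hl) = Submodule.span B {lin p m} := by
    rw [Submodule.range_liftQ, LinearMap.range_toSpanSingleton]
  rw [← hr]
  exact Module.Finite.of_surjective ((I.liftQ l hl).rangeRestrict.restrictScalars k)
    (I.liftQ l hl).surjective_rangeRestrict

/-! ### The ideals `B_{≥ n}` -/

/-- If `B_{≥ n}` has finite codimension, it is generated by a finite set `S`. Since `B = k + B_{≥
1}` and `B_{≥ 1} B_{≥ n} ⊆ B_{≥ n+1}`, the `k`-span of `S` already fills `B_{≥ n}` modulo `B_{≥
n+1}`. -/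
theorem exists_fg_sup_tail (n : ℕ) :
    ∃ V : Submodule k B, V.FG ∧ V ⊔ (tail 𝒜 n).restrictScalars k = ⊤ := by
  induction n with
  | zero =>
    refine ⟨⊥, Submodule.fg_bot, eq_top_iff.2 fun b _ => Submodule.mem_sup_right fun i hi => ?_⟩
    have := proj_mem (𝒜 := 𝒜) i b
    rwa [IsConnectedGraded.eq_bot_of_neg (𝒜 := 𝒜) i (by simpa using hi), Submodule.mem_bot] at this
  | succ n ih =>
    obtain ⟨V, hV, hVt⟩ := ih
    have hfin := finite_quotient_of_sup_eq_top (tail 𝒜 n) hV hVt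
    obtain ⟨S, hS⟩ := fg_of_finite (tail 𝒜 n) (isGraded_tail 𝒜 n) hfin
    refine ⟨V ⊔ Submodule.span k S, hV.sup (Submodule.fg_span S.finite_toSet), ?_⟩
    have key : ∀ x ∈ tail 𝒜 n, x ∈ Submodule.span k (S : Set B) ⊔
        (tail 𝒜 ((n + 1 : ℕ) : ℤ)).restrictScalars k := by
      intro x hx
      rw [← hS] at hx
      induction hx using Submodule.span_induction with
      | mem x hx => exact Submodule.mem_sup_left (Submodule.subset_span hx)
      | zero => exact zero_mem _
      | add x y _ _ hx hy => exact add_mem hx hy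
      | smul b x hx' ih =>
        have hxn : x ∈ tail 𝒜 n := hS ▸ hx'
        obtain ⟨c, hc⟩ := IsConnectedGraded.exists_algebraMap_eq (𝒜 := 𝒜) _ (proj_mem 0 b)
        -- Split `b` into its degree-zero scalar, absorbed by the `k`-span, and a part in `B_{≥ 1}`,
        -- which pushes `x` into `B_{≥ n+1}`.
        have h0 : b = algebraMap k B c + (b - algebraMap k B c) := by abel
        rw [h0, add_smul, algebraMap_smul]
        refine add_mem (Submodule.smul_mem _ c ih) (Submodule.mem_sup_right ?_)
        have hb : ∀ i < 1, GradedAlgebra.proj 𝒜 i (b - algebraMap k B c) = 0 := by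
          intro i hi
          rw [map_sub]
          rcases lt_or_eq_of_le (show i ≤ 0 by omega) with h | rfl
          · have h1 := proj_mem (𝒜 := 𝒜) i b
            have h2 := proj_mem (𝒜 := 𝒜) i (algebraMap k B c)
            rw [IsConnectedGraded.eq_bot_of_neg (𝒜 := 𝒜) i h, Submodule.mem_bot] at h1 h2
            rw [h1, h2, sub_zero]
          · rw [hc, proj_of_mem (proj_mem 0 b), sub_self]
        intro i hi
        obtain ⟨s, hs⟩ := exists_sum_proj (𝒜 := 𝒜) (b - algebraMap k B c)
        rw [← hs, Finset.sum_smul, map_sum]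
        refine Finset.sum_eq_zero fun j _ => ?_
        rcases lt_or_ge j 1 with h | h
        · rw [hb j h, zero_smul, map_zero]
        · have := (self 𝒜).comp_smul_of_mem_left (proj_mem j (b - algebraMap k B c)) (i - j) x
          rw [comp_self, comp_self, hxn (i - j) (by push_cast at hi; omega),
            show j + (i - j) = i by ring] at this
          exact this.trans (smul_zero _)
    rw [sup_assoc, eq_top_iff, ← hVt]
    exact sup_le_sup_left (fun x hx => key x hx) _

theorem finite_quot_tail (n : ℕ) : Module.Finite k (B ⧸ tail 𝒜 (n : ℤ)) := by
  obtain ⟨V, hV, hVt⟩ := exists_fg_sup_tail (𝒜 := 𝒜) n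
  exact finite_quotient_of_sup_eq_top _ hV hVt

end coherent

/-! ### Submodules of finite codimension -/

section codimension

variable {X Y : Type*} [AddCommGroup X] [Module k X] [Module B X] [IsScalarTower k B X]
  [AddCommGroup Y] [Module k Y] [Module B Y] [IsScalarTower k B Y]

theorem exists_fg_sup_eq_top (N : Submodule B X) (h : Module.Finite k (X ⧸ N)) :
    ∃ V : Submodule k X, V.FG ∧ V ⊔ N.restrictScalars k = ⊤ := by
  obtain ⟨V, hV⟩ := (N.restrictScalars k).exists_isCompl
  refine ⟨V, Module.Finite.iff_fg.1 ?_, by rw [sup_comm]; exact hV.sup_eq_top⟩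
  refine Module.Finite.of_injective ((N.mkQ.restrictScalars k).comp V.subtype) ?_
  rw [← LinearMap.ker_eq_bot, eq_bot_iff]
  intro v hv
  exact Subtype.ext ((Submodule.disjoint_def.1 hV.disjoint) v.1
    ((Submodule.Quotient.mk_eq_zero N).1 hv) v.2)

theorem finite_quotient_comap (l : X →ₗ[B] Y) (N : Submodule B Y) (h : Module.Finite k (Y ⧸ N)) :
    Module.Finite k (X ⧸ N.comap l) :=
  Module.Finite.of_injective (((N.comap l).mapQ N l le_rfl).restrictScalars k) (by
    have h0 : LinearMap.ker ((N.comap l).mapQ N l le_rfl) = ⊥ := by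
      rw [Submodule.mapQ, Submodule.ker_liftQ_eq_bot]
      intro x hx
      exact (Submodule.Quotient.mk_eq_zero N).1 hx
    exact (LinearMap.ker_eq_bot (f := (N.comap l).mapQ N l le_rfl)).1 h0)

theorem finite_quotient_map_subtype (I : Submodule B X) (h : Module.Finite k (X ⧸ I))
    (P : Submodule B I) (hP : Module.Finite k (I ⧸ P)) :
    Module.Finite k (X ⧸ P.map I.subtype) := by
  obtain ⟨V, hV, hVt⟩ := exists_fg_sup_eq_top I h
  obtain ⟨U, hU, hUt⟩ := exists_fg_sup_eq_top P hP
  refine finite_quotient_of_sup_eq_top _ (hV.sup (hU.map (I.subtype.restrictScalars k))) ?_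
  rw [eq_top_iff, ← hVt, sup_assoc]
  refine sup_le_sup_left (fun x hx => ?_) _
  obtain ⟨a, ha, p, hp, hap⟩ := Submodule.mem_sup.1
    (hUt ▸ Submodule.mem_top : (⟨x, hx⟩ : I) ∈ U ⊔ P.restrictScalars k)
  refine Submodule.mem_sup.2 ⟨a.1, ⟨a, ha, rfl⟩, p.1, ⟨p, hp, rfl⟩, congrArg Subtype.val hap⟩

end codimension

theorem isGraded_iSup (M : GrMod 𝒜) {J : Type*} {N : J → Submodule B M.carrier}
    (h : ∀ j, M.IsGraded (N j)) : M.IsGraded (⨆ j, N j) := by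
  intro m hm i
  induction hm using Submodule.iSup_induction' with
  | mem j x hx => exact Submodule.mem_iSup_of_mem j (h j x hx i)
  | zero => rw [map_zero]; exact zero_mem _
  | add x y _ _ hx hy => rw [map_add]; exact add_mem hx hy

theorem comp_shift (M : GrMod 𝒜) (n i : ℤ) (m : M.carrier) :
    (M.shift n).comp i m = M.comp (n + i) m := by
  obtain ⟨s, hs⟩ := M.exists_sum_comp m
  rw [← hs, map_sum, map_sum]
  refine Finset.sum_congr rfl fun j _ => ?_
  have hj := M.comp_mem j m
  have hj' : M.comp j m ∈ (M.shift n).grading (j - n) := by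
    change _ ∈ M.grading (n + (j - n))
    rwa [add_sub_cancel]
  by_cases h : j = n + i
  · obtain rfl : i = j - n := by omega
    rw [(M.shift n).comp_of_mem hj', add_sub_cancel, M.comp_of_mem hj]
  · rw [(M.shift n).comp_of_mem_ne hj' (by omega), M.comp_of_mem_ne hj h]

/-! ### Direct sums -/

/-- The direct sum of a family of graded modules. -/
noncomputable abbrev dsum {K : Type u} (X : K → GrMod 𝒜) : GrMod 𝒜 where
  carrier := Π₀ κ, (X κ).carrier
  grading i := ⨅ κ, ((X κ).grading i).comap (DFinsupp.lapply κ)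
  isInternal := by
    classical
    refine isInternal_of_proj _
      (fun i => DFinsupp.mapRange.linearMap fun κ => (X κ).comp i) ?_ ?_ fun x => ?_
    · intro i x hx
      ext κ
      exact (X κ).comp_of_mem ((Submodule.mem_iInf _).1 hx κ)
    · intro i j hij x hx
      ext κ
      exact (X κ).comp_of_mem_ne ((Submodule.mem_iInf _).1 hx κ) hij
    · induction x using DFinsupp.induction with
      | h0 => exact zero_mem _
      | ha κ b f _ _ hf =>
        refine add_mem ?_ hf
        obtain ⟨s, hs⟩ := (X κ).exists_sum_comp b
        rw [← hs, ← DFinsupp.lsingle_apply (R := k), map_sum]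
        refine sum_mem fun i _ => Submodule.mem_iSup_of_mem i ((Submodule.mem_iInf _).2 fun κ' => ?_)
        rw [Submodule.mem_comap, DFinsupp.lapply_apply, DFinsupp.lsingle_apply,
          DFinsupp.single_apply]
        split_ifs with h
        · subst h
          exact (X κ).comp_mem i b
        · exact zero_mem _
  smul_mem := by
    intro i j b m hb hm
    exact (Submodule.mem_iInf _).2 fun κ => (X κ).smul_mem hb ((Submodule.mem_iInf _).1 hm κ)

section dsum

variable {K : Type u} (X : K → GrMod 𝒜)

theorem mem_grading_dsum {i : ℤ} {x : (dsum X).carrier} :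
    x ∈ (dsum X).grading i ↔ ∀ κ, (show Π₀ κ, (X κ).carrier from x) κ ∈ (X κ).grading i :=
  Submodule.mem_iInf _

/-- The inclusion of a summand. -/
noncomputable def dsumι (κ : K) : X κ ⟶ dsum X :=
  letI := Classical.decEq K
  homMk (N := dsum X) (DFinsupp.lsingle (R := B) (M := fun κ => (X κ).carrier) κ) fun i x hx => (mem_grading_dsum X).2 fun κ' => by
    rw [DFinsupp.lsingle_apply, DFinsupp.single_apply]
    split_ifs with h
    · subst h
      exact hx
    · exact zero_mem _

/-- The projection to a summand. -/
noncomputable def dsumπ (κ : K) : dsum X ⟶ X κ :=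
  homMk (M := dsum X) (DFinsupp.lapply κ) fun i x hx => (mem_grading_dsum X).1 hx κ

theorem dsum_induction {p : (dsum X).carrier → Prop} (x : (dsum X).carrier) (h0 : p 0)
    (hadd : ∀ x y, p x → p y → p (x + y)) (hι : ∀ κ b, p (lin (dsumι X κ) b)) : p x := by
  classical
  have : ∀ y : Π₀ κ, (X κ).carrier, p y := fun y => by
    induction y using DFinsupp.induction with
    | h0 => exact h0
    | ha κ b f _ _ hf =>
      refine hadd _ _ ?_ hf
      have h := hι κ b
      change p (@DFinsupp.single K (fun κ => (X κ).carrier) _ (Classical.decEq K) κ b) at h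
      convert h
  exact this x

/-- Morphisms out of a direct sum. -/
noncomputable def dsumDesc {M : GrMod 𝒜} (f : ∀ κ, X κ ⟶ M) : dsum X ⟶ M :=
  letI := Classical.decEq K
  homMk (M := dsum X) (DFinsupp.lsum ℕ fun κ => lin (f κ)) fun i x hx => by
    classical
    rw [DFinsupp.lsum_apply_apply, DFinsupp.sumAddHom_apply]
    exact dfinsuppSum_mem _ _ _ fun κ _ => lin_mem (f κ) ((mem_grading_dsum X).1 hx κ)

theorem dsumι_desc {M : GrMod 𝒜} (f : ∀ κ, X κ ⟶ M) (κ : K) : dsumι X κ ≫ dsumDesc X f = f κ := by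
  let := Classical.decEq K
  exact hom_ext fun x => DFinsupp.lsum_single (M := fun κ => (X κ).carrier) ℕ (fun κ => lin (f κ)) κ x

theorem dsum_ext {x y : (dsum X).carrier} (h : ∀ κ, lin (dsumπ X κ) x = lin (dsumπ X κ) y) :
    x = y :=
  DFinsupp.ext (f := (show Π₀ κ, (X κ).carrier from x)) h

theorem dsumι_π_self (κ : K) : dsumι X κ ≫ dsumπ X κ = 𝟙 (X κ) := by
  let := Classical.decEq K
  exact hom_ext fun x => DFinsupp.single_eq_same (β := fun κ => (X κ).carrier)

theorem dsumι_π_of_ne {κ κ' : K} (h : κ ≠ κ') : dsumι X κ ≫ dsumπ X κ' = 0 := by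
  let := Classical.decEq K
  exact hom_ext fun x => DFinsupp.single_eq_of_ne (β := fun κ => (X κ).carrier) h.symm

theorem exists_finset_dsumπ_eq_zero (x : (dsum X).carrier) :
    ∃ s : Finset K, ∀ κ ∉ s, lin (dsumπ X κ) x = 0 := by
  classical
  exact ⟨DFinsupp.support (show Π₀ κ, (X κ).carrier from x),
    fun κ hκ => DFinsupp.notMem_support_iff.1 hκ⟩

variable {X} in
-- The finiteness behind compactness: the terms of this sum become the finite combination required
-- by `IsCompactPower.span_eq_top`.
theorem eq_sum_dsum {M : GrMod 𝒜} (g : M ⟶ dsum X) (s : Finset K)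
    (hs : ∀ m, ∀ κ ∉ s, lin (dsumπ X κ) (lin g m) = 0) :
    g = ∑ κ ∈ s, g ≫ dsumπ X κ ≫ dsumι X κ := by
  classical
  have hsum : ∀ (t : Finset K) (f : K → (M ⟶ dsum X)) (m : M.carrier),
      lin (∑ κ ∈ t, f κ) m = ∑ κ ∈ t, lin (f κ) m := fun t f m => by
    induction t using Finset.induction_on with
    | empty => rfl
    | insert a t ha ih => rw [Finset.sum_insert ha, Finset.sum_insert ha, lin_add, ih]
  refine hom_ext fun m => dsum_ext X fun κ => ?_
  have hc : ∀ κ', lin (dsumπ X κ) (lin (g ≫ dsumπ X κ' ≫ dsumι X κ') m) =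
      lin (dsumι X κ' ≫ dsumπ X κ) (lin (dsumπ X κ') (lin g m)) := fun _ => rfl
  rw [hsum, map_sum]
  simp only [hc]
  by_cases hκ : κ ∈ s
  · rw [Finset.sum_eq_single κ (fun κ' _ h => by rw [dsumι_π_of_ne X h, lin_zero])
      (fun h => absurd hκ h), dsumι_π_self, lin_id]
  · rw [hs m κ hκ]
    refine (Finset.sum_eq_zero fun κ' h => ?_).symm
    rw [dsumι_π_of_ne X (fun h' : κ' = κ => hκ (h' ▸ h)), lin_zero]

end dsum

/-! ### Ideals with the twists of `B` as quotients -/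

section twist

variable [GradedAlgebra 𝒜] [HasTwistIdeal 𝒜]

variable (𝒜) in
/-- There is a graded left ideal of finite codimension that surjects onto `B(-d)`. -/
theorem exists_surjective_twist (d : ℕ) : ∃ I : Submodule B B, (self 𝒜).IsGraded I ∧
    Module.Finite k (B ⧸ I) ∧ ∃ l : I →ₗ[B] B, Function.Surjective l ∧
      ∀ i, ∀ x : I, x.1 ∈ 𝒜 i → l x ∈ 𝒜 (i - d) := by
  induction d with
  | zero =>
    refine ⟨⊤, isGraded_top _, inferInstance, Submodule.subtype _, fun x => ⟨⟨x, trivial⟩, rfl⟩,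
      fun i x hx => ?_⟩
    rwa [Nat.cast_zero, sub_zero]
  | succ d ih =>
    obtain ⟨I, hI, hfin, l, hl, hdeg⟩ := ih
    obtain ⟨J, hJ, hJfin, G, -, ⟨e⟩⟩ := HasTwistIdeal.exists_ideal (𝒜 := 𝒜)
    -- The projection `J ≅ B(-1) ⊕ G → B(-1)`, which lowers degrees by one.
    let q : J →ₗ[B] B := (LinearMap.fst B B G.carrier).comp (lin e.hom)
    have hq : Function.Surjective q := fun b => by
      obtain ⟨x, hx⟩ := surjective_of_epi e.hom ((b, 0) : B × G.carrier)
      exact ⟨x, congrArg Prod.fst hx⟩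
    have hqdeg : ∀ i, ∀ x : J, x.1 ∈ 𝒜 i → q x ∈ 𝒜 (i - 1) := fun i x hx => by
      have : q x ∈ 𝒜 (-1 + i) := (lin_mem e.hom (m := x) hx).1
      rwa [neg_add_eq_sub] at this
    -- The preimage of `J` under `l` surjects onto `J`, hence by `q` onto `B`; the degree drops `d`
    -- and `1` add up.
    refine ⟨(J.comap l).map I.subtype, ?_,
      finite_quotient_map_subtype I hfin _ (finite_quotient_comap l J hJfin), ?_⟩
    · let f : (self 𝒜).ofSub I hI ⟶ (self 𝒜).shift (-d) :=
        homMk (M := (self 𝒜).ofSub I hI) (N := (self 𝒜).shift (-d)) l fun i x hx => by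
          have := hdeg i x hx
          rwa [← neg_add_eq_sub] at this
      have hJ' : ((self 𝒜).shift (-d)).IsGraded J := fun m hm i => by
        rw [comp_shift]
        exact hJ m hm _
      exact isGraded_map ((self 𝒜).incl I hI) (isGraded_comap f hJ')
    · have hmem : ∀ y : (J.comap l).map I.subtype, ∃ h : y.1 ∈ I, l ⟨y.1, h⟩ ∈ J := by
        rintro ⟨_, x, hx, rfl⟩
        exact ⟨x.2, hx⟩
      let r : (J.comap l).map I.subtype →ₗ[B] J :=
        (l.comp (Submodule.inclusion fun y hy => (hmem ⟨y, hy⟩).1)).codRestrict J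
          fun y => (hmem y).2
      refine ⟨q.comp r, fun b => ?_, fun i x hx => ?_⟩
      · obtain ⟨y, rfl⟩ := hq b
        obtain ⟨x, hx⟩ := hl y.1
        have hxJ : x ∈ J.comap l := by
          rw [Submodule.mem_comap, hx]; exact y.2
        exact ⟨⟨x.1, x, hxJ, rfl⟩, congrArg q (Subtype.ext hx)⟩
      · have := hqdeg _ (r x) (hdeg i ⟨x.1, (hmem x).1⟩ hx)
        rwa [sub_sub] at this

end twist

end GrMod

open GrMod

/-! ### The quotient functor -/

section quotientFunctor

variable [(fdim 𝒜).IsSerreClass]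

open ObjectProperty.SerreClassLocalization

/-- Factor `f` through its image: the exact quotient functor kills `f` exactly when the image lies
in `Fdim B`. -/
theorem toQGr_map_eq_zero_iff {M N : GrMod 𝒜} (f : M ⟶ N) :
    (toQGr 𝒜).map f = 0 ↔ ∀ m, N.IsFdimElt (lin f m) := by
  let e : M ⟶ N.ofSub _ (isGraded_range f) := homMk (N := N.ofSub _ (isGraded_range f))
    (lin f).rangeRestrict fun i x hx => lin_mem f hx
  have : Epi e := epi_of_surjective e (lin f).surjective_rangeRestrict
  have hf : f = e ≫ N.incl _ (isGraded_range f) := rfl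
  rw [hf, Functor.map_comp, map_comp_eq_zero_iff_of_epi_mono (toQGr 𝒜) (fdim 𝒜), fdim_ofSub_iff]
  constructor
  · intro h m
    exact h ⟨m, rfl⟩
  · rintro h _ ⟨m, rfl⟩
    exact h m

theorem fdim_cokernel_iff {M N : GrMod 𝒜} (f : M ⟶ N) :
    fdim 𝒜 (cokernel f) ↔ fdim 𝒜 (N.quot _ (isGraded_range f)) :=
  (fdim 𝒜).prop_iff_of_iso
    ((cokernelIsCokernel f).coconePointUniqueUpToIso (isColimitCoker f))

theorem isIso_toQGr_map_iff {M N : GrMod 𝒜} (f : M ⟶ N) :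
    IsIso ((toQGr 𝒜).map f) ↔
      (∀ m, lin f m = 0 → M.IsFdimElt m) ∧ fdim 𝒜 (N.quot _ (isGraded_range f)) := by
  rw [isIso_map_iff (toQGr 𝒜) (fdim 𝒜), ← fdim_kernel_iff, ← fdim_cokernel_iff]
  rfl

theorem isIso_toQGr_map_incl_iff (M : GrMod 𝒜) (N : Submodule B M.carrier) (hN : M.IsGraded N) :
    IsIso ((toQGr 𝒜).map (M.incl N hN)) ↔ fdim 𝒜 (M.quot N hN) := by
  have hr : LinearMap.range (lin (M.incl N hN)) = N := Submodule.range_subtype N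
  rw [isIso_toQGr_map_iff]
  have hiff : fdim 𝒜 (M.quot _ (isGraded_range (M.incl N hN))) ↔ fdim 𝒜 (M.quot N hN) := by
    simp only [hr]
  rw [hiff]
  refine and_iff_right fun m hm => ?_
  rw [M.injective_incl N hN (hm.trans (map_zero (lin (M.incl N hN))).symm)]
  exact isFdimElt_zero _

theorem isIso_toQGr_map_incl_self_iff [GradedAlgebra 𝒜] (I : Submodule B B)
    (hI : (self 𝒜).IsGraded I) :
    IsIso ((toQGr 𝒜).map ((self 𝒜).incl I hI)) ↔ Module.Finite k (B ⧸ I) := by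
  rw [isIso_toQGr_map_incl_iff, fdim_quot_self_iff]

instance mono_toQGr_map {M N : GrMod 𝒜} (f : M ⟶ N) [Mono f] : Mono ((toQGr 𝒜).map f) :=
  have := preservesMonomorphisms (toQGr 𝒜) (fdim 𝒜)
  inferInstance

instance epi_toQGr_map {M N : GrMod 𝒜} (f : M ⟶ N) [Epi f] : Epi ((toQGr 𝒜).map f) :=
  have := preservesEpimorphisms (toQGr 𝒜) (fdim 𝒜)
  inferInstance

noncomputable instance abelian_qGr : Abelian (QGr 𝒜) :=
  ObjectProperty.SerreClassLocalization.abelian (toQGr 𝒜) (fdim 𝒜)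

/-- Morphisms of `QGr B` are right fractions. -/
theorem exists_roof {M N : GrMod 𝒜} (φ : (toQGr 𝒜).obj M ⟶ (toQGr 𝒜).obj N) :
    ∃ (X : GrMod 𝒜) (s : X ⟶ M) (f : X ⟶ N), IsIso ((toQGr 𝒜).map s) ∧
      (toQGr 𝒜).map s ≫ φ = (toQGr 𝒜).map f := by
  obtain ⟨r, rfl⟩ := Localization.exists_rightFraction (toQGr 𝒜) (fdim 𝒜).isoModSerre φ
  exact ⟨r.X', r.s, r.f, Localization.inverts (toQGr 𝒜) (fdim 𝒜).isoModSerre _ r.hs,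
    r.map_s_comp_map _ _⟩

/-- Morphisms of `QGr B` are isomorphic to images of morphisms of `Gr B`. -/
theorem exists_arrow_iso {X Y : QGr 𝒜} (φ : X ⟶ Y) :
    ∃ (M N : GrMod 𝒜) (g : M ⟶ N) (a : X ≅ (toQGr 𝒜).obj M) (b : Y ≅ (toQGr 𝒜).obj N),
      φ = a.hom ≫ (toQGr 𝒜).map g ≫ b.inv := by
  obtain ⟨g, ⟨e⟩⟩ := (Localization.essSurj_mapArrow (toQGr 𝒜) (fdim 𝒜).isoModSerre).mem_essImage
    (Arrow.mk φ)
  let a : X ≅ (toQGr 𝒜).obj g.left := (Arrow.leftFunc.mapIso e).symm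
  let b : Y ≅ (toQGr 𝒜).obj g.right := (Arrow.rightFunc.mapIso e).symm
  refine ⟨g.left, g.right, g.hom, a, b, ?_⟩
  have hw : a.inv ≫ φ = (toQGr 𝒜).map g.hom ≫ b.inv := e.hom.w
  rw [← hw, Iso.hom_inv_id_assoc]

end quotientFunctor

/-! ### Morphisms out of `𝒪` -/

/-- Every graded left ideal of finite codimension contains a projective one. -/
def HasProjectiveIdeals (𝒜 : ℤ → Submodule k B) [GradedAlgebra 𝒜] : Prop :=
  ∀ I : Submodule B B, (self 𝒜).IsGraded I → Module.Finite k (B ⧸ I) →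
    ∃ J ≤ I, (self 𝒜).IsGraded J ∧ Module.Finite k (B ⧸ J) ∧ Module.Projective B J

section structureSheaf

variable [GradedAlgebra 𝒜] [(fdim 𝒜).IsSerreClass]

/-- The denominator `s` of a fraction representing `φ` has an image of finite codimension in `B`. A
projective ideal `J` inside that image lifts to the source of `s`, so `φ` becomes a genuine morphism
on `J`. -/
theorem HasProjectiveIdeals.exists_map_eq (hP : HasProjectiveIdeals 𝒜) {M : GrMod 𝒜}
    (φ : structureSheaf 𝒜 ⟶ (toQGr 𝒜).obj M) :
    ∃ (J : Submodule B B) (hJ : (self 𝒜).IsGraded J), Module.Finite k (B ⧸ J) ∧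
      Module.Projective B J ∧ ∃ g : (self 𝒜).ofSub J hJ ⟶ M,
        (toQGr 𝒜).map ((self 𝒜).incl J hJ) ≫ φ = (toQGr 𝒜).map g := by
  obtain ⟨X, s, f, hs, hsf⟩ := exists_roof φ
  have hI := isGraded_range s
  obtain ⟨J, hJI, hJ, hfin, hproj⟩ := hP _ hI
    ((fdim_quot_self_iff _ hI).1 ((isIso_toQGr_map_iff s).1 hs).2)
  let e : X ⟶ (self 𝒜).ofSub _ hI := homMk (N := (self 𝒜).ofSub _ hI)
    (lin s).rangeRestrict fun i x hx => lin_mem s hx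
  let i : (self 𝒜).ofSub J hJ ⟶ (self 𝒜).ofSub _ hI :=
    homMk (M := (self 𝒜).ofSub J hJ) (N := (self 𝒜).ofSub _ hI) (Submodule.inclusion hJI)
      fun _ _ hx => hx
  obtain ⟨h, hh⟩ := exists_lift_of_projective ((self 𝒜).ofSub J hJ) e
    (lin s).surjective_rangeRestrict i
  refine ⟨J, hJ, hfin, hproj, h ≫ f, ?_⟩
  have hi : (self 𝒜).incl J hJ = h ≫ s := by
    have : s = e ≫ (self 𝒜).incl _ hI := rfl
    rw [this, ← Category.assoc, hh]
    rfl
  rw [hi, Functor.map_comp, Functor.map_comp, Category.assoc, hsf]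

theorem HasProjectiveIdeals.projective (hP : HasProjectiveIdeals 𝒜) :
    Projective (structureSheaf 𝒜) where
  factors {E X} φ e he := by
    -- Up to isomorphism, `e` is the image of an epimorphism `e'` of `Gr B`. Represent the
    -- transported `φ` on a projective ideal and lift it along `e'` there.
    obtain ⟨X', Y', e', he', ⟨a⟩⟩ :=
      (ObjectProperty.SerreClassLocalization.epi_iff (toQGr 𝒜) (fdim 𝒜) e).1 he
    have hw : a.hom.left ≫ e = (toQGr 𝒜).map e' ≫ a.hom.right := a.hom.w
    obtain ⟨J, hJ, hfin, hproj, g, hg⟩ := hP.exists_map_eq (φ ≫ a.inv.right)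
    obtain ⟨h, hh⟩ := exists_lift_of_projective ((self 𝒜).ofSub J hJ) e' (surjective_of_epi e') g
    have := (isIso_toQGr_map_incl_self_iff J hJ).2 hfin
    refine ⟨inv ((toQGr 𝒜).map ((self 𝒜).incl J hJ)) ≫ (toQGr 𝒜).map h ≫ a.hom.left, ?_⟩
    have hr : a.inv.right ≫ a.hom.right = 𝟙 _ := congrArg CommaMorphism.right a.inv_hom_id
    rw [Category.assoc, Category.assoc, hw, ← Category.assoc ((toQGr 𝒜).map h), ← Functor.map_comp,
      hh, ← hg, Category.assoc, Category.assoc, hr, IsIso.inv_hom_id_assoc]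
    exact Category.comp_id φ

end structureSheaf

/-! ### `𝒪` is a separator and has compact powers -/

section coherent

variable [GradedAlgebra 𝒜] [IsConnectedGraded 𝒜] [IsLeftGradedCoherent 𝒜] [HasTwistIdeal 𝒜]

variable (𝒜) in
-- It suffices to treat a morphism `g` of `Gr B` and show that it sends homogeneous elements to
-- torsion. In degree `d ≥ 0`, an ideal surjecting onto `B(-d)` maps to `M` with `m` in its image,
-- and this map is a morphism out of `𝒪`.
theorem isSeparator_structureSheaf : IsSeparator (structureSheaf 𝒜) := by
  rw [Preadditive.isSeparator_iff]
  intro X Y φ hφ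
  obtain ⟨M, N, g, a, b, rfl⟩ := exists_arrow_iso φ
  have hzero : ∀ x : structureSheaf 𝒜 ⟶ (toQGr 𝒜).obj M, x ≫ (toQGr 𝒜).map g = 0 := by
    intro x
    have h1 := hφ (x ≫ a.inv)
    rwa [Category.assoc, Iso.inv_hom_id_assoc, ← Category.assoc, Preadditive.IsIso.comp_right_eq_zero]
      at h1
  -- elements of non-negative degree
  have hnonneg : ∀ d : ℤ, 0 ≤ d → ∀ m ∈ M.grading d, N.IsFdimElt (lin g m) := by
    intro d hd m hm
    obtain ⟨d, rfl⟩ := Int.eq_ofNat_of_zero_le hd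
    obtain ⟨I, hI, hfin, l, hl, hdeg⟩ := exists_surjective_twist 𝒜 d
    have := (isIso_toQGr_map_incl_self_iff I hI).2 hfin
    have h1 : (toQGr 𝒜).map (smulMap I hI d l hdeg M m hm ≫ g) = 0 := by
      rw [← cancel_epi (inv ((toQGr 𝒜).map ((self 𝒜).incl I hI))), comp_zero, Functor.map_comp,
        ← Category.assoc]
      exact hzero _
    rw [toQGr_map_eq_zero_iff] at h1
    obtain ⟨x, hx⟩ := hl 1
    have h2 := h1 x
    have h3 : lin (smulMap I hI d l hdeg M m hm) x = m := by
      change l x • m = m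
      rw [hx, one_smul]
    rwa [lin_comp, h3] at h2
  -- In degree `d < 0`, the ideal `B_{≥ -d}` moves `m` into degrees `≥ 0`; having finite
  -- codimension, it detects torsion.
  have hall : ∀ d : ℤ, ∀ m ∈ M.grading d, N.IsFdimElt (lin g m) := by
    intro d m hm
    refine isFdimElt_of_forall_smul (isGraded_tail 𝒜 ((-d).toNat : ℤ)) (finite_quot_tail _)
      (lin_mem g hm) fun b hb => ?_
    obtain ⟨s, hs⟩ := exists_sum_proj (𝒜 := 𝒜) b
    rw [← hs, Finset.sum_smul]
    refine Submodule.sum_mem N.torsion fun i _ => ?_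
    by_cases hi : i < ((-d).toNat : ℤ)
    · rw [hb i hi, zero_smul]
      exact zero_mem _
    · rw [← map_smul]
      exact hnonneg (i + d) (by omega) _ (M.smul_mem (proj_mem i b) hm)
  have hg : (toQGr 𝒜).map g = 0 := by
    rw [toQGr_map_eq_zero_iff]
    intro m
    obtain ⟨s, hs⟩ := M.exists_sum_comp m
    rw [← hs, map_sum]
    exact Submodule.sum_mem N.torsion fun i _ => hall i _ (M.comp_mem i m)
  rw [hg, zero_comp, comp_zero]

/-- Each `y κ` is represented on its own ideal `J κ`. No common ideal is needed, because `⨁ J κ → ⨁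
B` becomes invertible: `Fdim B` contains infinite sums of finite-dimensional modules. Spanning holds
because a map into `⨁ B` from a finitely generated ideal involves finitely many summands. -/
theorem HasProjectiveIdeals.isCompactPower (hP : HasProjectiveIdeals 𝒜) (K : Type u) :
    IsCompactPower fun κ => (toQGr 𝒜).map (dsumι (fun _ : K => self 𝒜) κ) where
  exists_desc {Y} y := by
    have := Localization.essSurj (toQGr 𝒜) (fdim 𝒜).isoModSerre
    let a := (toQGr 𝒜).objObjPreimageIso Y
    choose J hJ hfin hproj g hg using fun κ => hP.exists_map_eq (y κ ≫ a.inv)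
    let i := fun κ => (self 𝒜).incl (J κ) (hJ κ)
    let j : dsum (fun κ => (self 𝒜).ofSub (J κ) (hJ κ)) ⟶ dsum (fun _ : K => self 𝒜) :=
      dsumDesc _ fun κ => i κ ≫ dsumι (fun _ : K => self 𝒜) κ
    have hjπ : ∀ κ, j ≫ dsumπ (fun _ : K => self 𝒜) κ = dsumπ _ κ ≫ i κ := by
      intro κ
      refine hom_ext fun x => ?_
      refine dsum_induction _ (p := fun x => lin (j ≫ dsumπ (fun _ : K => self 𝒜) κ) x =
        lin (dsumπ _ κ ≫ i κ) x) x ((map_zero _).trans (map_zero _).symm)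
        (fun x y hx hy => by rw [map_add, map_add, hx, hy]) fun κ' b => ?_
      rw [← lin_comp, ← lin_comp, ← Category.assoc, ← Category.assoc, dsumι_desc, Category.assoc]
      by_cases h : κ' = κ
      · subst h
        rw [dsumι_π_self, dsumι_π_self, Category.id_comp, Category.comp_id]
      · rw [dsumι_π_of_ne _ h, dsumι_π_of_ne _ h, zero_comp, comp_zero]
    have hj : IsIso ((toQGr 𝒜).map j) := by
      rw [isIso_toQGr_map_iff]
      refine ⟨fun x hx => ?_, fun x => ?_⟩
      · have : x = 0 := dsum_ext _ fun κ => by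
          refine (self 𝒜).injective_incl (J κ) (hJ κ) ?_
          have h1 := congrArg (fun f => lin f x) (hjπ κ)
          change lin (dsumπ _ κ) (lin j x) = lin (i κ) (lin (dsumπ _ κ) x) at h1
          rw [hx, map_zero] at h1
          rw [map_zero, map_zero]
          exact h1.symm
        rw [this]
        exact isFdimElt_zero _
      · obtain ⟨x, rfl⟩ := surjective_proj _ _ (isGraded_range j) x
        refine dsum_induction _ (p := fun x => IsFdimElt _
          (lin ((dsum fun _ : K => self 𝒜).proj _ (isGraded_range j)) x)) x ?_
          (fun x y hx hy => ?_) fun κ b => ?_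
        · rw [map_zero]
          exact isFdimElt_zero _
        · rw [map_add]
          exact hx.add hy
        · let p := (dsum fun _ : K => self 𝒜).proj _ (isGraded_range j)
          -- The image in the cokernel of the `κ`-th copy of `B` factors through the
          -- finite-dimensional `B ⧸ J κ`, hence is torsion.
          obtain ⟨q, hq⟩ := exists_desc ((self 𝒜).proj (J κ) (hJ κ))
            ((self 𝒜).surjective_proj (J κ) (hJ κ)) (dsumι (fun _ : K => self 𝒜) κ ≫ p) (by
              intro z hz
              have hz' : z ∈ J κ := (Submodule.Quotient.mk_eq_zero _).1 hz
              refine (Submodule.Quotient.mk_eq_zero _).2 ⟨lin (dsumι _ κ) (⟨z, hz'⟩ : J κ), ?_⟩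
              rw [← lin_comp, dsumι_desc]
              rfl)
          rw [← lin_comp]
          change IsFdimElt _ (lin (dsumι _ κ ≫ p) b)
          rw [← hq, lin_comp]
          exact ((fdim_quot_self_iff (J κ) (hJ κ)).2 (hfin κ) _).map q
    refine ⟨inv ((toQGr 𝒜).map j) ≫ (toQGr 𝒜).map (dsumDesc _ g) ≫ a.hom, fun κ => ?_⟩
    have := (isIso_toQGr_map_incl_self_iff (J κ) (hJ κ)).2 (hfin κ)
    have h1 : (toQGr 𝒜).map (dsumι (fun _ : K => self 𝒜) κ) ≫ inv ((toQGr 𝒜).map j) =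
        inv ((toQGr 𝒜).map (i κ)) ≫
          (toQGr 𝒜).map (dsumι (fun κ => (self 𝒜).ofSub (J κ) (hJ κ)) κ) := by
      rw [IsIso.comp_inv_eq, Category.assoc, ← Functor.map_comp, dsumι_desc, Functor.map_comp,
        IsIso.inv_hom_id_assoc]
    rw [← Category.assoc, h1, Category.assoc, ← Category.assoc ((toQGr 𝒜).map (dsumι (fun κ => (self 𝒜).ofSub (J κ) (hJ κ)) κ)),
      ← Functor.map_comp, dsumι_desc, ← hg]
    simp [i]
  span_eq_top := by
    rw [eq_top_iff]
    intro x _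
    obtain ⟨J, hJ, hfin, hproj, g, hg⟩ := hP.exists_map_eq x
    have := (isIso_toQGr_map_incl_self_iff J hJ).2 hfin
    obtain ⟨T, hT⟩ : (⊤ : Submodule B J).FG :=
      (Module.Finite.iff_fg.2 (fg_of_finite J hJ hfin)).fg_top
    classical
    choose s hs using exists_finset_dsumπ_eq_zero (fun _ : K => self 𝒜)
    -- The supports of the images of the finitely many generators bound the support of `g` on all of
    -- `J`.
    have hsupp : ∀ m, ∀ κ ∉ T.biUnion fun t => s (lin g t), lin (dsumπ _ κ) (lin g m) = 0 := by
      intro m κ hκ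
      have hm : m ∈ Submodule.span B (T : Set J) := hT ▸ Submodule.mem_top
      have hle : Submodule.span B (T : Set J) ≤ LinearMap.ker (lin (g ≫ dsumπ _ κ)) := by
        rw [Submodule.span_le]
        intro t ht
        exact hs _ κ fun h => hκ (Finset.mem_biUnion.2 ⟨t, ht, h⟩)
      exact hle hm
    have hx : x = ∑ κ ∈ T.biUnion fun t => s (lin g t),
        (inv ((toQGr 𝒜).map ((self 𝒜).incl J hJ)) ≫ (toQGr 𝒜).map (g ≫ dsumπ _ κ)) ≫
          (toQGr 𝒜).map (dsumι (fun _ : K => self 𝒜) κ) := by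
      simp only [Category.assoc, ← Functor.map_comp]
      rw [← Preadditive.comp_sum, ← Functor.map_sum, ← eq_sum_dsum g _ hsupp, ← hg,
        IsIso.inv_hom_id_assoc]
    rw [hx]
    exact Submodule.sum_mem _ fun κ _ => Submodule.smul_mem _
      (MulOpposite.op (α := End (structureSheaf 𝒜)) (inv ((toQGr 𝒜).map ((self 𝒜).incl J hJ)) ≫ (toQGr 𝒜).map (g ≫ dsumπ _ κ)))
      (Submodule.subset_span ⟨κ, rfl⟩)

end coherent

/-! ### Subobjects of `𝒪` -/

section subobject

variable [(fdim 𝒜).IsSerreClass]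

/-- Write the inclusion of `Z` as a fraction with numerator `f`. The corestriction of `f` to its
image stays epi in `QGr B` and becomes mono there, so `Z` is the image of `f`. -/
theorem exists_subobject_eq_mk {M : GrMod 𝒜} (Z : Subobject ((toQGr 𝒜).obj M)) :
    ∃ (N : Submodule B M.carrier) (hN : M.IsGraded N),
      Z = Subobject.mk ((toQGr 𝒜).map (M.incl N hN)) := by
  have := Localization.essSurj (toQGr 𝒜) (fdim 𝒜).isoModSerre
  let a := (toQGr 𝒜).objObjPreimageIso (Z : QGr 𝒜)
  obtain ⟨X, s, f, hs, hsf⟩ := exists_roof (a.hom ≫ Z.arrow)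
  let e : X ⟶ M.ofSub _ (isGraded_range f) := homMk (N := M.ofSub _ (isGraded_range f))
    (lin f).rangeRestrict fun i x hx => lin_mem f hx
  have he : Epi e := epi_of_surjective e (lin f).surjective_rangeRestrict
  have hef : (toQGr 𝒜).map e ≫ (toQGr 𝒜).map (M.incl _ (isGraded_range f)) =
      (toQGr 𝒜).map s ≫ a.hom ≫ Z.arrow := by
    rw [hsf, ← Functor.map_comp]
    rfl
  have hmono : Mono ((toQGr 𝒜).map e ≫ (toQGr 𝒜).map (M.incl _ (isGraded_range f))) := by
    rw [hef]
    infer_instance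
  have hmono' : Mono ((toQGr 𝒜).map e) := mono_of_mono _ ((toQGr 𝒜).map (M.incl _ (isGraded_range f)))
  have hiso : IsIso ((toQGr 𝒜).map e) := isIso_of_mono_of_epi _
  refine ⟨_, isGraded_range f, ?_⟩
  rw [← Subobject.mk_arrow Z]
  refine (Subobject.mk_eq_mk_of_comm _ _
    ((asIso ((toQGr 𝒜).map e)).symm ≪≫ asIso ((toQGr 𝒜).map s) ≪≫ a) ?_).symm
  simp only [Iso.trans_hom, Iso.symm_hom, asIso_inv, asIso_hom, Category.assoc]
  rw [← hef, IsIso.inv_hom_id_assoc]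

/-- The composite `N → M → M ⧸ P` factors through `P` in `QGr B`, so it vanishes there and has
torsion values. -/
theorem isFdimElt_of_mk_le_mk {M : GrMod 𝒜} {N P : Submodule B M.carrier} (hN : M.IsGraded N)
    (hP : M.IsGraded P) (h : Subobject.mk ((toQGr 𝒜).map (M.incl N hN)) ≤
      Subobject.mk ((toQGr 𝒜).map (M.incl P hP))) {m : M.carrier} (hm : m ∈ N) :
    (M.quot P hP).IsFdimElt (lin (M.proj P hP) m) := by
  have h0 : M.incl P hP ≫ M.proj P hP = 0 :=
    hom_ext fun x => (Submodule.Quotient.mk_eq_zero P).2 x.2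
  have h1 : (toQGr 𝒜).map (M.incl N hN ≫ M.proj P hP) = 0 := by
    rw [Functor.map_comp, ← Subobject.ofMkLEMk_comp h, Category.assoc, ← Functor.map_comp, h0,
      Functor.map_zero, comp_zero]
  exact (toQGr_map_eq_zero_iff _).1 h1 ⟨m, hm⟩

theorem mk_le_mk_of_le {M : GrMod 𝒜} {N P : Submodule B M.carrier} (hN : M.IsGraded N)
    (hP : M.IsGraded P) (h : N ≤ P) : Subobject.mk ((toQGr 𝒜).map (M.incl N hN)) ≤
      Subobject.mk ((toQGr 𝒜).map (M.incl P hP)) := by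
  let i : M.ofSub N hN ⟶ M.ofSub P hP := homMk (M := M.ofSub N hN) (N := M.ofSub P hP)
    (Submodule.inclusion h) fun _ _ hx => hx
  exact Subobject.mk_le_mk_of_comm ((toQGr 𝒜).map i) (((toQGr 𝒜).map_comp _ _).symm.trans rfl)

end subobject

/-! ### `B` has no torsion -/

section torsionFree

variable [GradedAlgebra 𝒜] [IsConnectedGraded 𝒜]

/-- For a homogeneous torsion element `c`, the left annihilator has finite codimension, so it
contains some `B_{≥ n}` and with it a free right submodule. A basis element `r` of that submodule
satisfies `r c = 0`, which forces `c = 0`. -/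
theorem eq_zero_of_isFdimElt_self
    (h : ∀ n : ℕ, ∃ N : Submodule Bᵐᵒᵖ B, N ≠ ⊥ ∧ Module.Free Bᵐᵒᵖ N ∧ ∀ b ∈ N, b ∈ tail 𝒜 n)
    {b : B} (hb : (self 𝒜).IsFdimElt b) : b = 0 := by
  refine (self 𝒜).ext_comp fun i => ?_
  rw [map_zero]
  obtain ⟨N, hN, hfin, hbN⟩ := hb
  set c := (self 𝒜).comp i b with hc
  have hcN : c ∈ N := hN b hbN i
  have hci : c ∈ 𝒜 i := (self 𝒜).comp_mem i b
  let l : B →ₗ[B] N := LinearMap.toSpanSingleton B N ⟨c, hcN⟩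
  have hl : ∀ x, (l x).1 = x * c := fun x => rfl
  have hJ : (self 𝒜).IsGraded (LinearMap.ker l) := by
    intro x hx j
    rw [LinearMap.mem_ker, Subtype.ext_iff, hl] at hx ⊢
    have := (self 𝒜).comp_smul_of_mem hci j x
    rw [comp_self, ← smul_eq_mul, ← this, smul_eq_mul, hx]
    exact map_zero _
  have hJfin : Module.Finite k (B ⧸ LinearMap.ker l) := by
    have he : Function.Injective ((LinearMap.ker l).liftQ l le_rfl) :=
      LinearMap.ker_eq_bot.1 (Submodule.ker_liftQ_eq_bot _ _ _ le_rfl)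
    exact Module.Finite.of_injective (((LinearMap.ker l).liftQ l le_rfl).restrictScalars k) he
  obtain ⟨n, hn⟩ := exists_tail_le hJ hJfin
  obtain ⟨R, hR, hfree, hRn⟩ := h n
  have hRnt : Nontrivial R := (Submodule.nontrivial_iff_ne_bot).2 hR
  let bas := Module.Free.chooseBasis Bᵐᵒᵖ R
  obtain ⟨j⟩ := bas.index_nonempty
  have h0 : (bas j).1 * c = 0 := by
    rw [← hl]
    exact congrArg Subtype.val (hn (hRn _ (bas j).2))
  have h1 : MulOpposite.op c • bas j = 0 := Subtype.ext h0
  have h2 := congrArg (fun x => bas.repr x j) h1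
  simp only [map_smul, Module.Basis.repr_self, Finsupp.smul_single, smul_eq_mul, mul_one,
    Finsupp.single_eq_same, map_zero, Finsupp.coe_zero, Pi.zero_apply] at h2
  exact MulOpposite.op_eq_zero_iff c |>.1 h2

end torsionFree

/-! ### Finite generation of `𝒪`, and its endomorphism ring -/

section coherent

variable [GradedAlgebra 𝒜] [IsConnectedGraded 𝒜] [IsLeftGradedCoherent 𝒜] [HasTwistIdeal 𝒜]

variable (𝒜) in
-- Represent the subobjects by graded ideals. Their sum `T` represents `⊤`, so it has finite
-- codimension and is finitely generated; hence finitely many of the ideals already add up to `T`,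
-- and a single member of the directed family dominates these.
theorem top_mem_of_directedOn (S : Set (Subobject (structureSheaf 𝒜))) (hne : S.Nonempty)
    (hdir : DirectedOn (· ≤ ·) S) (hS : IsLUB S ⊤) : ⊤ ∈ S := by
  choose I hI hmk using fun Z : Subobject (structureSheaf 𝒜) => exists_subobject_eq_mk Z
  let T : Submodule B B := ⨆ Z : S, I Z.1
  have hT : (self 𝒜).IsGraded T := isGraded_iSup _ fun Z => hI Z.1
  have htop : Subobject.mk ((toQGr 𝒜).map ((self 𝒜).incl T hT)) = ⊤ := by
    refine top_le_iff.1 (hS.2 fun Z hZ => ?_)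
    conv_lhs => rw [hmk Z]
    exact mk_le_mk_of_le _ _ (le_iSup (fun Z : S => I Z.1) ⟨Z, hZ⟩)
  have hfin : Module.Finite k (B ⧸ T) := by
    rw [← isIso_toQGr_map_incl_self_iff T hT, Subobject.isIso_iff_mk_eq_top]
    exact htop
  have hcpt : IsCompactElement T := (Submodule.fg_iff_compact T).1 (fg_of_finite T hT hfin)
  obtain ⟨s, hs⟩ := CompleteLattice.IsCompactElement.exists_finset_of_le_iSup _ hcpt (fun Z : S => I Z.1) le_rfl
  have hne' : Nonempty S := hne.to_subtype
  obtain ⟨Y, hY⟩ : ∃ Y : S, ∀ Z ∈ s, Z ≤ Y :=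
    have : IsDirected S (· ≤ ·) := ⟨fun a b => by
      obtain ⟨c, hc, h1, h2⟩ := hdir a.1 a.2 b.1 b.2
      exact ⟨⟨c, hc⟩, h1, h2⟩⟩
    s.exists_le
  -- The ideals are arbitrary representatives, so an inequality of subobjects gives containment only
  -- up to torsion.
  have hle : T ≤ ((self 𝒜).quot (I Y.1) (hI Y.1)).torsion.comap
      (lin ((self 𝒜).proj (I Y.1) (hI Y.1))) := by
    refine hs.trans (iSup₂_le fun Z hZ x hx => ?_)
    refine isFdimElt_of_mk_le_mk (hI Z.1) (hI Y.1) ?_ hx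
    rw [← hmk, ← hmk]
    exact hY Z hZ
  -- `T` sends the class of `1` into torsion and has finite codimension, so that class is itself
  -- torsion; as it generates the quotient, the whole quotient is torsion.
  have h1 : ((self 𝒜).quot (I Y.1) (hI Y.1)).IsFdimElt (lin ((self 𝒜).proj (I Y.1) (hI Y.1)) 1) := by
    refine isFdimElt_of_forall_smul hT hfin
      (lin_mem ((self 𝒜).proj (I Y.1) (hI Y.1)) (SetLike.one_mem_graded 𝒜)) fun b hb => ?_
    have := hle hb
    rw [← map_smul, smul_eq_mul, mul_one]
    exact this
  have h2 : fdim 𝒜 ((self 𝒜).quot (I Y.1) (hI Y.1)) := by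
    intro x
    obtain ⟨b, rfl⟩ := surjective_proj _ _ (hI Y.1) x
    have := ((self 𝒜).quot (I Y.1) (hI Y.1)).torsion.smul_mem b h1
    rwa [← map_smul, smul_eq_mul, mul_one] at this
  have h3 := (isIso_toQGr_map_incl_iff (self 𝒜) (I Y.1) (hI Y.1)).2 h2
  rw [Subobject.isIso_iff_mk_eq_top, ← hmk] at h3
  exact h3 ▸ Y.2

theorem HasProjectiveIdeals.isProgenerator (hP : HasProjectiveIdeals 𝒜) :
    IsProgenerator (structureSheaf 𝒜) where
  projective := hP.projective
  isSeparator := isSeparator_structureSheaf 𝒜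
  finitelyGenerated := top_mem_of_directedOn 𝒜

theorem HasProjectiveIdeals.isEquivalence (hP : HasProjectiveIdeals 𝒜) :
    (preadditiveCoyonedaObj (structureSheaf 𝒜) :
      QGr 𝒜 ⥤ ModuleCat.{u} (End (structureSheaf 𝒜))ᵐᵒᵖ).IsEquivalence :=
  have := hP.projective
  isEquivalence_preadditiveCoyonedaObj (isSeparator_structureSheaf 𝒜)
    fun K => ⟨_, _, hP.isCompactPower K⟩

/-! ### The endomorphism ring of `𝒪` -/

instance isIso_toQGr_map_incl_tail (n : ℕ) :
    IsIso ((toQGr 𝒜).map ((self 𝒜).incl _ (isGraded_tail 𝒜 n))) :=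
  (isIso_toQGr_map_incl_self_iff _ _).2 (finite_quot_tail n)

variable (𝒜) in
/-- The endomorphism of `𝒪` induced by an endomorphism of `B_{≥ n}`. -/
noncomputable def endTailToEnd (n : ℕ) : End (tailMod 𝒜 n) →ₐ[k] End (structureSheaf 𝒜) :=
  AlgHom.ofLinearMap
    { toFun := fun f => inv ((toQGr 𝒜).map ((self 𝒜).incl _ (isGraded_tail 𝒜 n))) ≫
        (toQGr 𝒜).map f ≫ (toQGr 𝒜).map ((self 𝒜).incl _ (isGraded_tail 𝒜 n))
      map_add' := fun f g => by
        rw [Functor.map_add, Preadditive.add_comp, Preadditive.comp_add]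
      map_smul' := fun c f => by
        rw [Functor.map_smul, Linear.smul_comp, Linear.comp_smul]
        rfl }
    (by
      change inv _ ≫ (toQGr 𝒜).map (𝟙 _) ≫ _ = 𝟙 _
      rw [CategoryTheory.Functor.map_id, Category.id_comp, IsIso.inv_hom_id])
    (fun f g => by
      -- Multiplication in `End` is composition in the reverse order, on both sides.
      change inv _ ≫ (toQGr 𝒜).map (g ≫ f) ≫ _ = (inv _ ≫ _ ≫ _) ≫ (inv _ ≫ _ ≫ _)
      simp)

theorem map_incl_comp_endTailToEnd (n : ℕ) (f : End (tailMod 𝒜 n)) :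
    (toQGr 𝒜).map ((self 𝒜).incl _ (isGraded_tail 𝒜 n)) ≫ endTailToEnd 𝒜 n f =
      (toQGr 𝒜).map f ≫ (toQGr 𝒜).map ((self 𝒜).incl _ (isGraded_tail 𝒜 n)) :=
  IsIso.hom_inv_id_assoc _ _

theorem endTailToEnd_restrictEnd {n m : ℕ} (h : n ≤ m) (f : End (tailMod 𝒜 n)) :
    endTailToEnd 𝒜 m (restrictEnd 𝒜 h f) = endTailToEnd 𝒜 n f := by
  let i : tailMod 𝒜 m ⟶ tailMod 𝒜 n := homMk (M := tailMod 𝒜 m) (N := tailMod 𝒜 n)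
    (Submodule.inclusion (tail_le h)) fun _ _ hx => hx
  have hi : (toQGr 𝒜).map ((self 𝒜).incl _ (isGraded_tail 𝒜 m)) =
      (toQGr 𝒜).map i ≫ (toQGr 𝒜).map ((self 𝒜).incl _ (isGraded_tail 𝒜 n)) := by
    rw [← Functor.map_comp]
    rfl
  have hif : (toQGr 𝒜).map (restrictEnd 𝒜 h f) ≫ (toQGr 𝒜).map i =
      (toQGr 𝒜).map i ≫ (toQGr 𝒜).map f := by
    rw [← Functor.map_comp, ← Functor.map_comp]
    rfl
  rw [← cancel_epi ((toQGr 𝒜).map ((self 𝒜).incl _ (isGraded_tail 𝒜 m))),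
    map_incl_comp_endTailToEnd, hi, Category.assoc, map_incl_comp_endTailToEnd, ← Category.assoc,
    hif, Category.assoc]

/-- Restrict a representative `J → B` of `φ` to some `B_{≥ n} ⊆ J`; preserving degrees, it takes
values in `B_{≥ n}`. -/
theorem HasProjectiveIdeals.exists_endTailToEnd_eq (hP : HasProjectiveIdeals 𝒜)
    (φ : End (structureSheaf 𝒜)) : ∃ (n : ℕ) (f : End (tailMod 𝒜 n)), endTailToEnd 𝒜 n f = φ := by
  obtain ⟨J, hJ, hfin, -, g, hg⟩ := hP.exists_map_eq φ
  obtain ⟨n, hn⟩ := exists_tail_le hJ hfin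
  let i : tailMod 𝒜 n ⟶ (self 𝒜).ofSub J hJ :=
    homMk (M := tailMod 𝒜 n) (N := (self 𝒜).ofSub J hJ) (Submodule.inclusion hn) fun _ _ hx => hx
  have hmem : ∀ x, lin (i ≫ g) x ∈ tail 𝒜 n := by
    intro x j hj
    have h1 := comp_lin (i ≫ g) j x
    have h2 := comp_lin ((self 𝒜).incl _ (isGraded_tail 𝒜 n)) j x
    have h3 : (tailMod 𝒜 n).comp j x = 0 := Subtype.ext (h2.symm.trans (by
      rw [comp_self]
      exact x.2 j hj))
    rwa [h3, map_zero, comp_self] at h1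
  let f : tailMod 𝒜 n ⟶ tailMod 𝒜 n := homMk (M := tailMod 𝒜 n) (N := tailMod 𝒜 n)
    ((lin (i ≫ g)).codRestrict _ hmem) fun j x hx => lin_mem (i ≫ g) hx
  refine ⟨n, f, ?_⟩
  have hi : (toQGr 𝒜).map ((self 𝒜).incl _ (isGraded_tail 𝒜 n)) =
      (toQGr 𝒜).map i ≫ (toQGr 𝒜).map ((self 𝒜).incl J hJ) := by
    rw [← Functor.map_comp]
    rfl
  rw [← cancel_epi ((toQGr 𝒜).map ((self 𝒜).incl _ (isGraded_tail 𝒜 n))),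
    map_incl_comp_endTailToEnd]
  conv_rhs => rw [hi, Category.assoc, hg]
  rw [← Functor.map_comp, ← Functor.map_comp]
  rfl

/-- An endomorphism that dies in `QGr B` has torsion values, and `B` has no torsion by `h`. -/
theorem endTailToEnd_injective (h : ∀ b, (self 𝒜).IsFdimElt b → b = 0) (n : ℕ) :
    Function.Injective (endTailToEnd 𝒜 n) := by
  rw [injective_iff_map_eq_zero]
  intro f hf
  have h1 := map_incl_comp_endTailToEnd n f
  rw [hf, ← Functor.map_comp] at h1
  have h2 := (toQGr_map_eq_zero_iff _).1 (h1.symm.trans comp_zero)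
  exact hom_ext fun x => Subtype.ext (h _ (h2 x))

variable (𝒜) in
/-- The map from the direct limit of the rings `End(B_{≥ n})` to `End(𝒪)`. -/
noncomputable def limEndToEnd : limEnd 𝒜 →ₐ[k] End (structureSheaf 𝒜) :=
  DirectLimit.Algebra.lift (fun n : ℕ => End (tailMod 𝒜 n)) (fun _ _ h => restrictEnd 𝒜 h) _
    (endTailToEnd 𝒜) fun _ _ h f => endTailToEnd_restrictEnd h f

theorem limEndToEnd_of (n : ℕ) (f : End (tailMod 𝒜 n)) :
    limEndToEnd 𝒜 (DirectLimit.Algebra.of (fun n : ℕ => End (tailMod 𝒜 n))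
      (fun _ _ h => restrictEnd 𝒜 h) n f) = endTailToEnd 𝒜 n f := rfl

theorem HasProjectiveIdeals.bijective_limEndToEnd (hP : HasProjectiveIdeals 𝒜)
    (h : ∀ b, (self 𝒜).IsFdimElt b → b = 0) : Function.Bijective (limEndToEnd 𝒜) := by
  constructor
  · rw [injective_iff_map_eq_zero]
    intro x
    induction x using DirectLimit.induction with
    | _ n f =>
      intro hx
      have hf : f = 0 := endTailToEnd_injective h n
        ((limEndToEnd_of n f).symm.trans (hx.trans (map_zero _).symm))
      subst hf
      exact map_zero (DirectLimit.Algebra.of (fun n : ℕ => End (tailMod 𝒜 n))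
        (fun _ _ h => restrictEnd 𝒜 h) n)
  · intro φ
    obtain ⟨n, f, rfl⟩ := hP.exists_endTailToEnd_eq φ
    exact ⟨_, limEndToEnd_of n f⟩

end coherent

end NCProj

theorem theorem2 {k B : Type u} [Field k] [Ring B] [Algebra k B] (𝒜 : ℤ → Submodule k B)
    [GradedAlgebra 𝒜] [NCProj.IsConnectedGraded 𝒜] [NCProj.IsLeftGradedCoherent 𝒜]
    [NCProj.HasTwistIdeal 𝒜]
    (hfree : ∀ I : Submodule B B, (NCProj.GrMod.self 𝒜).IsGraded I → Module.Finite k (B ⧸ I) →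
      ∃ J ≤ I, J ≠ ⊥ ∧ (NCProj.GrMod.self 𝒜).IsGraded J ∧ Module.Finite k (B ⧸ J) ∧
        Module.Free B J) :
    NCProj.IsProgenerator (NCProj.structureSheaf 𝒜) ∧
    (preadditiveCoyonedaObj (NCProj.structureSheaf 𝒜) :
      NCProj.QGr 𝒜 ⥤ ModuleCat.{u} (End (NCProj.structureSheaf 𝒜))ᵐᵒᵖ).IsEquivalence ∧
    ((∀ n : ℕ, ∃ N : Submodule Bᵐᵒᵖ B, N ≠ ⊥ ∧ Module.Free Bᵐᵒᵖ N ∧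
        ∀ b ∈ N, b ∈ NCProj.tail 𝒜 n) →
      ∃ e : NCProj.limEnd 𝒜 ≃ₐ[k] End (NCProj.structureSheaf 𝒜),
        ∀ (n : ℕ) (f : End (NCProj.tailMod 𝒜 n)),
          (NCProj.toQGr 𝒜).map ((NCProj.GrMod.self 𝒜).incl _ (NCProj.isGraded_tail 𝒜 n)) ≫
              e (DirectLimit.Algebra.of (fun n : ℕ => End (NCProj.tailMod 𝒜 n))
                (fun _ _ h => NCProj.restrictEnd 𝒜 h) n f) =
            (NCProj.toQGr 𝒜).map f ≫
              (NCProj.toQGr 𝒜).map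
                ((NCProj.GrMod.self 𝒜).incl _ (NCProj.isGraded_tail 𝒜 n))) := by
  -- The freeness in (c) enters only through projectivity.
  have hP : NCProj.HasProjectiveIdeals 𝒜 := fun I hI hfin => by
    obtain ⟨J, hJI, -, hJ, hJfin, hJfree⟩ := hfree I hI hfin
    exact ⟨J, hJI, hJ, hJfin, inferInstance⟩
  refine ⟨hP.isProgenerator, hP.isEquivalence, fun h => ?_⟩
  refine ⟨AlgEquiv.ofBijective (NCProj.limEndToEnd 𝒜)
    (hP.bijective_limEndToEnd fun b => NCProj.eq_zero_of_isFdimElt_self h), fun n f => ?_⟩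
  exact NCProj.map_incl_comp_endTailToEnd n f
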